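/- Let $d\ge 2$ and let $\Omega\subset\mathbb R^d$ be a nonempty bounded open set. Let $\lambda_1\le\lambda_2\le\cdots$ be the eigenvalues, counted with multiplicity, of the Dirichlet Laplacian on $\Omega$, i.e. of the self-adjoint operator in $L^2(\Omega)$ associated with the quadratic form $\int_\Omega|\nabla u|^2$ on $H^1_0(\Omega)$. Write $|\Omega|$ for the Lebesgue measure of $\Omega$, $|\partial\Omega|$ for the $(d-1)$-dimensional Hausdorff measure of its boundary (normalized to agree with Lebesgue measure on $\mathbb R^{d-1}$), $\delta(x)=\operatorname{dist}(x,\partial\Omega)$, $r_\Omega=\max_{x\in\Omega}\delta(x)$, $\omega_h=\{x\in\Omega:\delta(x)\le h\}$ for $h>0$, and $$C_d=4\pi^2\left(\frac{\pi^{d/2}}{\Gamma(1+d/2)}\right)^{-2/d}.$$ Assume that $|\partial\Omega|<\infty$ and $\lim_{h\to0^+}|\omega_h|/h=|\partial\Omega|$. For positive integers $k$ put $$h(k)=(d+2)^{1/2}(2C_d)^{-1/2}|\Omega|^{1/d}k^{-1/d},\qquad k_0=|\Omega|\,r_\Omega^{-d}\left(\frac{d+2}{2C_d}\right)^{d/2}.$$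 Then there is a real sequence $R(k)$ with $R(k)=o(k^{1/d})$ as $k\to\infty$ such that for all integers $k\ge k_0$ $$\frac1k\sum_{j=1}^k\lambda_j\le\frac{d}{d+2}C_d\left(\frac{k}{|\Omega|}\right)^{2/d}+2\left(\frac{2C_d}{d+2}\right)^{1/2}\frac{|\partial\Omega|}{|\Omega|}\left(\frac{k}{|\Omega|}\right)^{1/d}+R(k),$$ and such that for all integers $k>k_0$, with $h=h(k)$, one has $|\omega_{h}|<|\Omega|$ and $$R(k)=\left(\frac{2}{d+2}C_d\left(\frac{k}{|\Omega|}\right)^{2/d}+\frac1{h^2}\right)\cdot\frac{h|\partial\Omega|\,|\omega_{h}|+|\Omega|\left(|\omega_{h}|-h|\partial\Omega|\right)}{|\Omega|\left(|\Omega|-|\omega_{h}|\right)}.$$ -/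

import Mathlib

open MeasureTheory Filter Topology Asymptotics
open scoped ContDiff Gradient RealInnerProductSpace

noncomputable section

namespace DirichletMeans

/-- Euclidean space `ℝ^d`. -/
abbrev E (d : ℕ) : Type := EuclideanSpace ℝ (Fin d)

/-- The real Hilbert space `L²(Ω)`. -/
abbrev L2 {d : ℕ} (Ω : Set (E d)) : Type := Lp ℝ 2 (volume.restrict Ω)

/-- The real Hilbert space `L²(Ω; ℝ^d)` of square integrable vector fields. -/
abbrev L2Vec {d : ℕ} (Ω : Set (E d)) : Type := Lp (E d) 2 (volume.restrict Ω)

/-- The pairs `(φ, ∇φ)` in `L²(Ω) × L²(Ω; ℝ^d)` with `φ ∈ C_c^∞(Ω)`. -/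
def testPairs {d : ℕ} (Ω : Set (E d)) : Set (WithLp 2 (L2 Ω × L2Vec Ω)) :=
  {p | ∃ φ : E d → ℝ, ContDiff ℝ ∞ φ ∧ HasCompactSupport φ ∧ tsupport φ ⊆ Ω ∧
    (∀ᵐ x ∂(volume.restrict Ω), p.fst x = φ x) ∧
    (∀ᵐ x ∂(volume.restrict Ω), p.snd x = ∇ φ x)}

/-- The Sobolev space `H¹₀(Ω)`, the closure of `C_c^∞(Ω)` in the `H¹` norm
`(‖u‖₂² + ‖∇u‖₂²)^(1/2)`; an element is a pair `(u, ∇u)`, `∇u` the weak gradient of `u`. -/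
def H10 {d : ℕ} (Ω : Set (E d)) : Submodule ℝ (WithLp 2 (L2 Ω × L2Vec Ω)) :=
  (Submodule.span ℝ (testPairs Ω)).topologicalClosure

/-- `u` is in the domain of the Dirichlet Laplacian `-Δ_Ω^D`, and `-Δ_Ω^D u = f`. The operator is
the self-adjoint operator of the quadratic form `∫_Ω |∇u|²` on `H¹₀(Ω)`, that is,
`u ∈ H¹₀(Ω)` and `∫_Ω ∇u · ∇v = ∫_Ω f v` for all `v ∈ H¹₀(Ω)`. -/
def NegDirichletLaplacian {d : ℕ} (Ω : Set (E d)) (u f : L2 Ω) : Prop :=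
  ∃ g : L2Vec Ω, WithLp.toLp 2 (u, g) ∈ H10 Ω ∧ ∀ p ∈ H10 Ω, ⟪g, p.snd⟫ = ⟪f, p.fst⟫

/-- The eigenspace of the Dirichlet Laplacian for `t`, with `0` included
(it is `{0}` if `t` is not an eigenvalue). -/
def dirichletEigenspace {d : ℕ} (Ω : Set (E d)) (t : ℝ) : Submodule ℝ (L2 Ω) where
  carrier := {u | NegDirichletLaplacian Ω u (t • u)}
  zero_mem' := ⟨0, (H10 Ω).zero_mem, fun p _ => by simp⟩
  add_mem' := by
    rintro u v ⟨g, hg, hg'⟩ ⟨k, hk, hk'⟩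
    refine ⟨g + k, (H10 Ω).add_mem hg hk, fun p hp => ?_⟩
    rw [inner_add_left, smul_add, inner_add_left, hg' p hp, hk' p hp]
  smul_mem' := by
    rintro c u ⟨g, hg, hg'⟩
    refine ⟨c • g, (H10 Ω).smul_mem c hg, fun p hp => ?_⟩
    rw [smul_comm t c u]
    exact (real_inner_smul_left g p.snd c).trans
      ((congrArg (c * ·) (hg' p hp)).trans (real_inner_smul_left (t • u) p.fst c).symm)

/-- The number of eigenvalues `≤ t` of the Dirichlet Laplacian, counted with multiplicity:
the dimension of the span of all its eigenfunctions with eigenvalue `≤ t`. -/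
def countingFunction {d : ℕ} (Ω : Set (E d)) (t : ℝ) : Cardinal :=
  Module.rank ℝ ↥(⨆ s ∈ Set.Iic t, dirichletEigenspace Ω s)

/-- The `j`-th eigenvalue (`j ≥ 1`) of the Dirichlet Laplacian on `Ω`, in increasing order and
counted with multiplicity. -/
def dirichletEigenvalue {d : ℕ} (Ω : Set (E d)) (j : ℕ) : ℝ :=
  sInf {t : ℝ | (j : Cardinal) ≤ countingFunction Ω t}

/-- `δ(x)`, the distance of `x` to `∂Ω`. -/
def bdryDist {d : ℕ} (Ω : Set (E d)) (x : E d) : ℝ := Metric.infDist x (frontier Ω)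

/-- The inradius `r_Ω`, the greatest value of `δ` on `Ω`. -/
def inradius {d : ℕ} (Ω : Set (E d)) : ℝ := sSup (bdryDist Ω '' Ω)

/-- The inner tubular neighbourhood `ω_h = {x ∈ Ω : δ(x) ≤ h}` of `∂Ω`. -/
def tube {d : ℕ} (Ω : Set (E d)) (h : ℝ) : Set (E d) := {x ∈ Ω | bdryDist Ω x ≤ h}

/-- `|∂Ω|`, the `(d-1)`-dimensional Hausdorff measure of the boundary, normalized so that it is
the Lebesgue measure on `ℝ^(d-1)`. -/
def surfaceMeasure {d : ℕ} (Ω : Set (E d)) : ENNReal :=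
  Measure.euclideanHausdorffMeasure (d - 1) (frontier Ω)

/-- The class `𝒮` of bounded sets with `|ω_h| / h → |∂Ω| < ∞` as `h → 0⁺`. -/
structure ClassS {d : ℕ} (Ω : Set (E d)) : Prop where
  bounded : Bornology.IsBounded Ω
  finite : surfaceMeasure Ω ≠ ⊤
  tendsto : Tendsto (fun h : ℝ => volume (tube Ω h) / ENNReal.ofReal h) (𝓝[>] 0)
    (𝓝 (surfaceMeasure Ω))

/-- The volume `ω_d = π^(d/2) / Γ(1 + d/2)` of the unit ball of `ℝ^d`. -/
def ballVolume (d : ℕ) : ℝ := Real.pi ^ ((d : ℝ) / 2) / Real.Gamma (1 + (d : ℝ) / 2)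

/-- The classical constant `C_d = 4π² ω_d^(-2/d)`. -/
def classicalConst (d : ℕ) : ℝ := 4 * Real.pi ^ 2 * ballVolume d ^ (-(2 / (d : ℝ)))

/-- `h(k) = ((d+2)/(2 C_d))^(1/2) V^(1/d) k^(-1/d)`, where `V = |Ω|`. -/
def tubeWidth (d : ℕ) (V : ℝ) (k : ℕ) : ℝ :=
  ((d : ℝ) + 2) ^ (1 / 2 : ℝ) * (2 * classicalConst d) ^ (-(1 / 2) : ℝ) * V ^ (1 / (d : ℝ)) *
    (k : ℝ) ^ (-(1 / (d : ℝ)))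

/-- The explicit remainder
`((2/(d+2)) C_d (k/V)^(2/d) + 1/h²) (h S w + V (w - h S)) / (V (V - w))` at `h = h(k)`,
where `V = |Ω|`, `S = |∂Ω|` and `w = |ω_h|`. -/
def remainder (d : ℕ) (V S w : ℝ) (k : ℕ) : ℝ :=
  (2 / ((d : ℝ) + 2) * classicalConst d * ((k : ℝ) / V) ^ (2 / (d : ℝ)) +
      1 / tubeWidth d V k ^ 2) *
    ((tubeWidth d V k * S * w + V * (w - tubeWidth d V k * S)) / (V * (V - w)))

end DirichletMeans

end

/-! The trial functions are cut-off plane waves `f_ξ = φ(x) e^{2πi ξ·x}`, averaged over a ball of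
frequencies. Let `q_i` be L²-orthonormal eigenfunctions for `λ_i`. Removing from `f` its components
along the first k of them leaves a function with Rayleigh quotient at least `λ_k`, whence `λ_k ‖f‖²
- ‖∇f‖² ≤ ∑_{i ≤ k} (λ_k - λ_i) |⟪q_i, f⟫|²` (`exists_eigenvectors_averaged`). Insert `f_ξ` and
integrate over `|ξ| ≤ ρ`. By Plancherel `∫ |⟪q_i, f_ξ⟫|² dξ ≤ ‖φ q_i‖² ≤ 1`, and the left side
depends only on `A = ∫ φ²` and `B = ∫ |∇φ|²`. Taking ρ with `|B_ρ| A = k` makes `λ_k` cancel and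
bounds the mean by `d/(d+2) C_d (k/A)^{2/d} + B/A` (`sum_dirichletEigenvalue_le`).

Now let φ approximate `min(1, δ/h)`, so that `A ≥ V - w` and, in the limit, `B ≤ w/h²`, where `w =
|ω_h|`. Bernoulli's inequality for `(V/(V-w))^{2/d}` leaves an excess of at most `(a + 1/h²)
w/(V-w)` over the Weyl term, with `a = 2/(d+2) C_d (k/V)^{2/d}`. Since `w ≈ hS`, this is about `(ah
+ 1/h) S/V`, which is smallest at `h = a^{-1/2}`, the chosen `tubeWidth`. The minimum is the
boundary term of the theorem; the rest is `remainder`, of order `o(k^{1/d})` because `w/h → S`.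

Eigenfunctions exist by Rellich's theorem, obtained from the same Fourier estimates. As `H10 Ω`
carries the full H¹ norm, the spectral numbers `M i` correspond to `λ + 1`. Only upper bounds on
`dirichletEigenvalue` are needed, so completeness of the eigenfunctions never enters. -/

namespace DirichletMeans

/-! ### Eigenvectors of compact embeddings and the averaged variational principle -/

section Spectral

variable {H V : Type*} [NormedAddCommGroup H] [InnerProductSpace ℝ H] [CompleteSpace H]
  [NormedAddCommGroup V] [InnerProductSpace ℝ V] [CompleteSpace V]

/-- The norm of a nonzero compact positive self-adjoint operator is an eigenvalue. -/
theorem hasEigenvalue_norm_of_compact_nonneg {T : V →L[ℝ] V} (hc : IsCompactOperator T)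
    (hs : T.IsSymmetric) (hp : ∀ x, 0 ≤ ⟪T x, x⟫) (h0 : T ≠ 0) :
    Module.End.HasEigenvalue (T : Module.End ℝ V) ‖T‖ := by
  have hn : ‖T‖ ≠ 0 := by simpa using h0
  by_contra hne
  have : Nontrivial V := by
    by_contra hV
    rw [not_nontrivial_iff_subsingleton] at hV
    exact h0 (Subsingleton.elim _ _)
  have hres : (algebraMap ℝ ℝ) ‖T‖ ∈ resolventSet ℝ T := by
    by_contra hmem
    exact hne ((hc.hasEigenvalue_iff_mem_spectrum hn).2 hmem)
  -- If `‖T‖` were in the resolvent set, all Rayleigh quotients would stay below it by a fixed ε,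
  -- although for symmetric `T` their absolute values have supremum `‖T‖`.
  obtain ⟨ε, hε, hle⟩ := T.rayleighQuotient_le_of_norm_mem_resolventSet hres
  have h1 : ‖T‖ ≤ ‖T‖ - ε := by
    conv_lhs => rw [T.norm_eq_iSup_rayleighQuotient hs]
    refine ciSup_le fun x => ?_
    rw [abs_of_nonneg]
    · exact hle x
    · exact div_nonneg (hp x) (sq_nonneg _)
  linarith

/-- By symmetry `T` also preserves `Wᗮ`, where its restriction is again compact, symmetric and
nonnegative, and is nonzero by `hne`. So κ can be the norm of that restriction. -/
theorem exists_top_eigenvector_orthogonal {T : V →L[ℝ] V} (hc : IsCompactOperator T)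
    (hs : T.IsSymmetric) (hp : ∀ x, 0 ≤ ⟪T x, x⟫) (W : Submodule ℝ V) (hW : ∀ x ∈ W, T x ∈ W)
    (hne : ∃ x ∈ Wᗮ, ⟪T x, x⟫ ≠ 0) :
    ∃ p ∈ Wᗮ, ∃ κ : ℝ, 0 < κ ∧ p ≠ 0 ∧ T p = κ • p ∧ ∀ x ∈ Wᗮ, ⟪T x, x⟫ ≤ κ * ‖x‖ ^ 2 := by
  have hinv : ∀ x ∈ Wᗮ, T x ∈ Wᗮ := by
    intro x hx
    rw [Submodule.mem_orthogonal] at hx ⊢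
    intro u hu
    have := hs u x
    simp only [ContinuousLinearMap.coe_coe] at this
    rw [← this]
    exact hx _ (hW u hu)
  let S : Wᗮ →L[ℝ] Wᗮ := T.restrict hinv
  have hSc : IsCompactOperator S := hc.restrict' hinv
  have hSs : S.IsSymmetric := hs.restrict_invariant hinv
  have hSapp : ∀ x : Wᗮ, ((S x : Wᗮ) : V) = T x := fun x => rfl
  have hSp : ∀ x, 0 ≤ ⟪S x, x⟫ := fun x => hp x
  obtain ⟨x, hx, hx0⟩ := hne
  have hS0 : S ≠ 0 := by
    intro h
    apply hx0
    have : ((S ⟨x, hx⟩ : Wᗮ) : V) = 0 := by rw [h]; rfl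
    rw [hSapp] at this
    simp only at this
    rw [this, inner_zero_left]
  obtain ⟨p, hpe⟩ := (hasEigenvalue_norm_of_compact_nonneg hSc hSs hSp hS0).exists_hasEigenvector
  refine ⟨p, p.2, ‖S‖, lt_of_le_of_ne S.opNorm_nonneg (fun h => hS0 ?_), ?_, ?_, ?_⟩
  · ext y
    have := S.le_opNorm y
    rw [← h, zero_mul] at this
    rw [norm_le_zero_iff.1 this]; rfl
  · simpa using hpe.2
  · have := hpe.apply_eq_smul
    exact congrArg Subtype.val this
  · intro y hy
    calc ⟪T y, y⟫ = ⟪S ⟨y, hy⟩, (⟨y, hy⟩ : Wᗮ)⟫ := rfl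
      _ ≤ ‖S ⟨y, hy⟩‖ * ‖(⟨y, hy⟩ : Wᗮ)‖ := real_inner_le_norm _ _
      _ ≤ (‖S‖ * ‖(⟨y, hy⟩ : Wᗮ)‖) * ‖(⟨y, hy⟩ : Wᗮ)‖ := by gcongr; exact S.le_opNorm _
      _ = ‖S‖ * ‖y‖ ^ 2 := by rw [Submodule.coe_norm]; ring

/-- The first `k` eigenvectors of a compact embedding `j`, as successive maximizers of the
Rayleigh quotient `‖j x‖² / ‖x‖²`. -/
theorem exists_successive_eigenvectors {j : V →L[ℝ] H} (hc : IsCompactOperator j)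
    (hinf : ∀ (k : ℕ) (q : ℕ → V), ∃ x, (∀ i < k, ⟪q i, x⟫ = 0) ∧ j x ≠ 0) (k : ℕ) :
    ∃ (q : ℕ → V) (M : ℕ → ℝ), ∀ i < k, 0 < M i ∧ ‖j (q i)‖ = 1 ∧
      (∀ l < i, ⟪q l, q i⟫ = 0) ∧ (∀ x, ⟪q i, x⟫ = M i * ⟪j (q i), j x⟫) ∧
      ∀ x, (∀ l < i, ⟪q l, x⟫ = 0) → M i * ‖j x‖ ^ 2 ≤ ‖x‖ ^ 2 := by
  induction k with
  | zero => exact ⟨0, 0, by simp⟩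
  | succ k ih =>
    obtain ⟨q, M, h⟩ := ih
    -- Since `⟪T x, x⟫ = ‖j x‖²`, minimizing `‖x‖² / ‖j x‖²` means maximizing the Rayleigh quotient
    -- of `T = j* j`; the value `M` is the reciprocal of an eigenvalue of `T`.
    let T : V →L[ℝ] V := (ContinuousLinearMap.adjoint j).comp j
    have hT : ∀ x y, ⟪T x, y⟫ = ⟪j x, j y⟫ := fun x y => by
      simp [T, ContinuousLinearMap.adjoint_inner_left]
    have hTc : IsCompactOperator T := hc.clm_comp (ContinuousLinearMap.adjoint j)
    have hTs : T.IsSymmetric := fun x y => by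
      change ⟪T x, y⟫ = ⟪x, T y⟫
      rw [hT, real_inner_comm (T y) x, hT, real_inner_comm]
    have hTp : ∀ x, 0 ≤ ⟪T x, x⟫ := fun x => by rw [hT]; exact real_inner_self_nonneg
    let W : Submodule ℝ V := Submodule.span ℝ (q '' Set.Iio k)
    have hTq : ∀ i < k, T (q i) = (M i)⁻¹ • q i := fun i hi => by
      refine ext_inner_right ℝ fun v => ?_
      rw [hT, real_inner_smul_left, (h i hi).2.2.2.1]
      field_simp [(h i hi).1.ne']
    have hWT : ∀ x ∈ W, T x ∈ W := by
      intro x hx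
      induction hx using Submodule.span_induction with
      | mem x hx =>
        obtain ⟨i, hi, rfl⟩ := hx
        rw [hTq i hi]
        exact W.smul_mem _ (Submodule.subset_span ⟨i, hi, rfl⟩)
      | zero => simp
      | add x y _ _ hx hy => rw [map_add]; exact W.add_mem hx hy
      | smul c x _ hx => rw [map_smul]; exact W.smul_mem _ hx
    have hWorth : ∀ x, x ∈ Wᗮ ↔ ∀ i < k, ⟪q i, x⟫ = 0 := by
      intro x
      rw [Submodule.mem_orthogonal]
      constructor
      · intro hx i hi
        exact hx _ (Submodule.subset_span ⟨i, hi, rfl⟩)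
      · intro hx u hu
        induction hu using Submodule.span_induction with
        | mem u hu => obtain ⟨i, hi, rfl⟩ := hu; exact hx i hi
        | zero => simp
        | add u v _ _ hu hv => rw [inner_add_left, hu, hv, add_zero]
        | smul c u _ hu => rw [real_inner_smul_left, hu, mul_zero]
    obtain ⟨x₀, hx₀, hjx₀⟩ := hinf k q
    obtain ⟨p, hpW, κ, hκ, hp0, hTpκ, hmax⟩ := exists_top_eigenvector_orthogonal hTc hTs hTp W hWT
      ⟨x₀, (hWorth x₀).2 hx₀, by rw [hT]; simpa using hjx₀⟩
    have hnorm : ‖j p‖ ^ 2 = κ * ‖p‖ ^ 2 := by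
      rw [← real_inner_self_eq_norm_sq, ← hT, hTpκ, real_inner_smul_left,
        real_inner_self_eq_norm_sq]
    have hjp : ‖j p‖ ≠ 0 := by
      intro h0
      rw [h0] at hnorm
      have : 0 < κ * ‖p‖ ^ 2 := by have := norm_pos_iff.2 hp0; positivity
      linarith [hnorm]
    refine ⟨Function.update q k (‖j p‖⁻¹ • p), Function.update M k κ⁻¹, fun i hi => ?_⟩
    rcases Nat.lt_succ_iff_lt_or_eq.1 hi with hi | rfl
    · have hne : i ≠ k := hi.ne
      obtain ⟨h1, h2, h3, h4, h5⟩ := h i hi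
      have hl : ∀ l < i, Function.update q k (‖j p‖⁻¹ • p) l = q l := fun l hl =>
        Function.update_of_ne (hl.trans hi).ne _ _
      simp only [Function.update_of_ne hne]
      refine ⟨h1, h2, fun l hl' => by rw [hl l hl', h3 l hl'], h4, fun x hx => h5 x fun l hl' => ?_⟩
      rw [← hl l hl', hx l hl']
    · have hl : ∀ l < i, Function.update q i (‖j p‖⁻¹ • p) l = q l := fun l hl =>
        Function.update_of_ne hl.ne _ _
      simp only [Function.update_self]
      refine ⟨inv_pos.2 hκ, ?_, ?_, ?_, ?_⟩
      · rw [map_smul, norm_smul, norm_inv, norm_norm, inv_mul_cancel₀ hjp]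
      · intro l hl'
        rw [hl l hl', real_inner_smul_right, (hWorth p).1 hpW l hl', mul_zero]
      · intro x
        rw [map_smul, real_inner_smul_left, real_inner_smul_left, ← hT, hTpκ, real_inner_smul_left]
        field_simp
      · intro x hx
        have hxW : x ∈ Wᗮ := (hWorth x).2 fun l hl' => by rw [← hl l hl', hx l hl']
        have := hmax x hxW
        rw [hT, real_inner_self_eq_norm_sq] at this
        rw [inv_mul_le_iff₀ hκ]
        exact this

/-- Eigenvectors of a compact embedding, with the averaged variational principle. -/
theorem exists_eigenvectors_averaged {j : V →L[ℝ] H} (hc : IsCompactOperator j)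
    (hinf : ∀ (k : ℕ) (q : ℕ → V), ∃ x, (∀ i < k, ⟪q i, x⟫ = 0) ∧ j x ≠ 0) (k : ℕ) :
    ∃ (q : ℕ → V) (M : ℕ → ℝ),
      (∀ i < k + 1, ‖j (q i)‖ = 1) ∧
      (∀ i < k + 1, ∀ l < k + 1, i ≠ l → ⟪j (q i), j (q l)⟫ = 0) ∧
      (∀ i < k + 1, ∀ x, ⟪q i, x⟫ = M i * ⟪j (q i), j x⟫) ∧
      (∀ l < k + 1, ∀ i ≤ l, M i ≤ M l) ∧
      ∀ x, M k * ‖j x‖ ^ 2 - ‖x‖ ^ 2 ≤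
        ∑ i ∈ Finset.range (k + 1), (M k - M i) * ⟪j (q i), j x⟫ ^ 2 := by
  obtain ⟨q, M, h⟩ := exists_successive_eigenvectors hc hinf (k + 1)
  have horth : ∀ i < k + 1, ∀ l < k + 1, i ≠ l → ⟪q i, q l⟫ = 0 := by
    intro i hi l hl hil
    rcases lt_or_gt_of_ne hil with hlt | hlt
    · exact (h l hl).2.2.1 i hlt
    · rw [real_inner_comm]; exact (h i hi).2.2.1 l hlt
  have horthj : ∀ i < k + 1, ∀ l < k + 1, i ≠ l → ⟪j (q i), j (q l)⟫ = 0 := by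
    intro i hi l hl hil
    have h1 := (h i hi).2.2.2.1 (q l)
    rw [horth i hi l hl hil] at h1
    exact (mul_eq_zero.1 h1.symm).resolve_left (h i hi).1.ne'
  have hself : ∀ i < k + 1, ‖q i‖ ^ 2 = M i := by
    intro i hi
    rw [← real_inner_self_eq_norm_sq, (h i hi).2.2.2.1, real_inner_self_eq_norm_sq, (h i hi).2.1]
    ring
  refine ⟨q, M, fun i hi => (h i hi).2.1, horthj, fun i hi => (h i hi).2.2.2.1, ?_, ?_⟩
  -- Monotonicity: `q l` is admissible in the minimum problem that defines `M i`.
  · intro l hl i hil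
    have := (h i (hil.trans_lt hl)).2.2.2.2 (q l) fun m hm =>
      horth m (by omega) l hl (by omega)
    rwa [(h l hl).2.1, hself l hl, one_pow, mul_one] at this
  · intro x
    set c : ℕ → ℝ := fun i => ⟪j (q i), j x⟫ with hcdef
    set s : V := ∑ i ∈ Finset.range (k + 1), c i • q i with hs
    have hqs : ∀ i < k + 1, ⟪q i, s⟫ = c i * M i := by
      intro i hi
      rw [hs, inner_sum, Finset.sum_eq_single i]
      · rw [real_inner_smul_right, real_inner_self_eq_norm_sq, hself i hi]
      · intro l hl hli
        rw [real_inner_smul_right, horth i hi l (Finset.mem_range.1 hl) hli.symm, mul_zero]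
      · intro hni; exact absurd (Finset.mem_range.2 hi) hni
    have hjqs : ∀ i < k + 1, ⟪j (q i), j s⟫ = c i := by
      intro i hi
      have := (h i hi).2.2.2.1 s
      rw [hqs i hi, mul_comm] at this
      exact (mul_left_cancel₀ (h i hi).1.ne' this).symm
    have hqx : ∀ i < k + 1, ⟪q i, x⟫ = c i * M i := fun i hi => by
      rw [(h i hi).2.2.2.1 x, mul_comm]
    -- The vector `x - s` is orthogonal to all earlier eigenvectors, so it competes in the minimum
    -- problem for `M k`. Expanding the squares gives the claim; the component along `q k` enters
    -- with the factor `M k - M k = 0`.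
    have hk := (h k (Nat.lt_succ_self k)).2.2.2.2 (x - s) fun l hl => by
      rw [inner_sub_right, hqs l (by omega), hqx l (by omega), sub_self]
    have e1 : ⟪x, s⟫ = ∑ i ∈ Finset.range (k + 1), c i ^ 2 * M i := by
      rw [hs, inner_sum]
      refine Finset.sum_congr rfl fun i hi => ?_
      rw [real_inner_smul_right, real_inner_comm, hqx i (Finset.mem_range.1 hi)]; ring
    have e2 : ‖s‖ ^ 2 = ∑ i ∈ Finset.range (k + 1), c i ^ 2 * M i := by
      rw [← real_inner_self_eq_norm_sq]
      conv_lhs => rw [hs, sum_inner]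
      refine Finset.sum_congr rfl fun i hi => ?_
      rw [real_inner_smul_left, ← hs, hqs i (Finset.mem_range.1 hi)]; ring
    have e3 : ⟪j x, j s⟫ = ∑ i ∈ Finset.range (k + 1), c i ^ 2 := by
      rw [hs, map_sum, inner_sum]
      refine Finset.sum_congr rfl fun i hi => ?_
      rw [map_smul, real_inner_smul_right, real_inner_comm]; simp only [hcdef]; ring
    have e4 : ‖j s‖ ^ 2 = ∑ i ∈ Finset.range (k + 1), c i ^ 2 := by
      rw [← real_inner_self_eq_norm_sq]
      have hjs : j s = ∑ i ∈ Finset.range (k + 1), c i • j (q i) := by simp [hs]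
      nth_rw 1 [hjs]
      rw [sum_inner]
      refine Finset.sum_congr rfl fun i hi => ?_
      rw [real_inner_smul_left, hjqs i (Finset.mem_range.1 hi)]; ring
    rw [map_sub, norm_sub_sq_real, norm_sub_sq_real, e1, e2, e3, e4] at hk
    have e5 : ∑ i ∈ Finset.range (k + 1), (M k - M i) * c i ^ 2 =
        M k * ∑ i ∈ Finset.range (k + 1), c i ^ 2 -
          ∑ i ∈ Finset.range (k + 1), c i ^ 2 * M i := by
      rw [Finset.mul_sum, ← Finset.sum_sub_distrib]
      exact Finset.sum_congr rfl fun i _ => by ring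
    rw [e5]
    linarith

end Spectral

/-! ### A compactness criterion -/

section Compactness

variable {H V : Type*} [NormedAddCommGroup H] [InnerProductSpace ℝ H] [CompleteSpace H]
  [NormedAddCommGroup V] [InnerProductSpace ℝ V] [CompleteSpace V]

/-- An operator that is small on subspaces of finite codimension is compact. -/
theorem isCompactOperator_of_small_on_finite_codim {j : V →L[ℝ] H}
    (h : ∀ ε > 0, ∃ F : Set H, F.Finite ∧ ∀ x, (∀ f ∈ F, ⟪f, j x⟫ = 0) → ‖j x‖ ≤ ε * ‖x‖) :
    IsCompactOperator j := by
  have hcl : IsClosed {f : V →L[ℝ] H | IsCompactOperator f} := isClosed_setOfPred_isCompactOperator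
  refine hcl.closure_subset (Metric.mem_closure_iff.2 fun ε hε => ?_)
  obtain ⟨F, hF, hx⟩ := h (ε / 2) (by positivity)
  -- For `x ∈ Wᗮ` the vector `j x` is orthogonal to `F`, so `j` is small there and lies within `ε /
  -- 2` of the finite-rank operator `j ∘ P_W`.
  let W : Submodule ℝ V := Submodule.span ℝ (ContinuousLinearMap.adjoint j '' F)
  have : FiniteDimensional ℝ W := FiniteDimensional.span_of_finite ℝ (hF.image _)
  refine ⟨(j.comp W.subtypeL).comp W.orthogonalProjectionOnto, ?_, ?_⟩
  · have h1 : IsCompactOperator (j.comp W.subtypeL) :=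
      isCompactOperator_of_locallyCompactSpace_rng (j.comp W.subtypeL)
    exact h1.comp_clm W.orthogonalProjectionOnto
  · rw [dist_eq_norm]
    refine lt_of_le_of_lt (ContinuousLinearMap.opNorm_le_bound _ (half_pos hε).le fun x => ?_)
      (half_lt_self hε)
    have hval : (j - (j.comp W.subtypeL).comp W.orthogonalProjectionOnto) x =
        j (x - W.starProjection x) := by
      simp
    have hmem : x - W.starProjection x ∈ Wᗮ := Submodule.sub_starProjection_mem_orthogonal x
    rw [hval]
    refine (hx _ fun f hf => ?_).trans ?_
    · rw [← ContinuousLinearMap.adjoint_inner_left]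
      exact (Submodule.mem_orthogonal _ _).1 hmem _ (Submodule.subset_span ⟨f, hf, rfl⟩)
    · gcongr
      have h2 : ‖Wᗮ.starProjection x‖ ≤ ‖x‖ := Wᗮ.norm_starProjection_apply_le x
      rwa [Submodule.starProjection_orthogonal_val] at h2

end Compactness

/-! ### Test functions, H¹₀(Ω) and the Dirichlet eigenspaces -/

variable {d : ℕ} {Ω : Set (E d)}

/-- Test functions on `Ω`. -/
structure IsTest (Ω : Set (E d)) (φ : E d → ℝ) : Prop where
  smooth : ContDiff ℝ ∞ φ
  compact : HasCompactSupport φ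
  supp : tsupport φ ⊆ Ω

theorem continuous_gradient {φ : E d → ℝ} (h : ContDiff ℝ ∞ φ) : Continuous (∇ φ) :=
  (InnerProductSpace.toDual ℝ (E d)).symm.continuous.comp (h.continuous_fderiv (by simp))

theorem hasCompactSupport_gradient {φ : E d → ℝ} (h : HasCompactSupport φ) :
    HasCompactSupport (∇ φ) :=
  (h.fderiv ℝ).comp_left (g := (InnerProductSpace.toDual ℝ (E d)).symm) (map_zero _)

theorem gradient_eq_zero_of_notMem_tsupport {φ : E d → ℝ} {x : E d} (hx : x ∉ tsupport φ) :
    ∇ φ x = 0 := by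
  have : fderiv ℝ φ x = 0 := by
    by_contra hne
    exact hx (support_fderiv_subset ℝ hne)
  simp [gradient, this]

namespace IsTest

theorem memLp {φ : E d → ℝ} (h : IsTest Ω φ) : MemLp φ 2 (volume.restrict Ω) :=
  h.smooth.continuous.memLp_of_hasCompactSupport h.compact

theorem memLp_gradient {φ : E d → ℝ} (h : IsTest Ω φ) : MemLp (∇ φ) 2 (volume.restrict Ω) :=
  (continuous_gradient h.smooth).memLp_of_hasCompactSupport (hasCompactSupport_gradient h.compact)

theorem eq_zero_of_notMem {φ : E d → ℝ} (h : IsTest Ω φ) {x : E d} (hx : x ∉ Ω) : φ x = 0 :=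
  image_eq_zero_of_notMem_tsupport fun hx' => hx (h.supp hx')

theorem gradient_eq_zero_of_notMem {φ : E d → ℝ} (h : IsTest Ω φ) {x : E d} (hx : x ∉ Ω) :
    ∇ φ x = 0 :=
  gradient_eq_zero_of_notMem_tsupport fun hx' => hx (h.supp hx')

theorem mul_left {φ g : E d → ℝ} (h : IsTest Ω φ) (hg : ContDiff ℝ ∞ g) :
    IsTest Ω (fun x => g x * φ x) :=
  ⟨hg.mul h.smooth, h.compact.mul_left, (tsupport_mul_subset_right).trans h.supp⟩

/-- The element `(φ, ∇φ)` of `H¹₀(Ω)`. -/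
noncomputable def toH10 {φ : E d → ℝ} (h : IsTest Ω φ) : H10 Ω :=
  ⟨WithLp.toLp 2 (h.memLp.toLp φ, h.memLp_gradient.toLp (∇ φ)),
    Submodule.le_topologicalClosure _ (Submodule.subset_span
      ⟨φ, h.smooth, h.compact, h.supp, h.memLp.coeFn_toLp, h.memLp_gradient.coeFn_toLp⟩)⟩

end IsTest

theorem zero_mem_testPairs : (0 : WithLp 2 (L2 Ω × L2Vec Ω)) ∈ testPairs Ω := by
  refine ⟨0, contDiff_const, HasCompactSupport.zero, by simp [tsupport], ?_, ?_⟩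
  · exact Lp.coeFn_zero _ _ _
  · filter_upwards [Lp.coeFn_zero (E d) 2 (volume.restrict Ω)] with x hx
    have : ∇ (0 : E d → ℝ) x = 0 := by
      simp [gradient, fderiv_zero]
    rw [this]
    exact hx

theorem add_mem_testPairs {p q : WithLp 2 (L2 Ω × L2Vec Ω)} (hp : p ∈ testPairs Ω)
    (hq : q ∈ testPairs Ω) : p + q ∈ testPairs Ω := by
  obtain ⟨φ, h1, h2, h3, h4, h5⟩ := hp
  obtain ⟨ψ, k1, k2, k3, k4, k5⟩ := hq
  refine ⟨φ + ψ, h1.add k1, h2.add k2, (tsupport_add φ ψ).trans (Set.union_subset h3 k3), ?_, ?_⟩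
  · filter_upwards [h4, k4, Lp.coeFn_add p.fst q.fst] with x a b c
    rw [WithLp.add_fst, c, Pi.add_apply, a, b, Pi.add_apply]
  · filter_upwards [h5, k5, Lp.coeFn_add p.snd q.snd] with x a b c
    rw [WithLp.add_snd, c, Pi.add_apply, a, b]
    simp only [gradient]
    rw [fderiv_add (h1.differentiable (by simp) x) (k1.differentiable (by simp) x), map_add]

theorem smul_mem_testPairs {p : WithLp 2 (L2 Ω × L2Vec Ω)} (c : ℝ) (hp : p ∈ testPairs Ω) :
    c • p ∈ testPairs Ω := by
  obtain ⟨φ, h1, h2, h3, h4, h5⟩ := hp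
  refine ⟨c • φ, h1.const_smul c, h2.smul_left (f := fun _ => c),
    (tsupport_smul_subset_right (fun _ => c) φ).trans h3, ?_, ?_⟩
  · filter_upwards [h4, Lp.coeFn_smul c p.fst] with x a b
    rw [WithLp.smul_fst, b, Pi.smul_apply, a, Pi.smul_apply]
  · filter_upwards [h5, Lp.coeFn_smul c p.snd] with x a b
    rw [WithLp.smul_snd, b, Pi.smul_apply, a]
    simp only [gradient]
    rw [fderiv_const_smul (h1.differentiable (by simp) x), map_smul]

/-- Because no linear combinations have to be added, even a nonlinear closed condition, such as a
quadratic inequality, need only be checked on single test functions. -/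
theorem span_testPairs : (Submodule.span ℝ (testPairs Ω) : Set _) = testPairs Ω := by
  refine Set.Subset.antisymm (fun p hp => ?_) Submodule.subset_span
  refine Submodule.span_induction (p := fun x _ => x ∈ testPairs Ω) (fun x hx => hx)
    zero_mem_testPairs (fun x y _ _ hx hy => add_mem_testPairs hx hy)
    (fun c x _ hx => smul_mem_testPairs c hx) hp

/-- A closed condition that holds for test functions holds on `H¹₀(Ω)`. -/
theorem H10_induction {C : Set (WithLp 2 (L2 Ω × L2Vec Ω))} (hC : IsClosed C)
    (h : testPairs Ω ⊆ C) : ∀ p ∈ H10 Ω, p ∈ C := by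
  intro p hp
  have hp' : p ∈ closure (testPairs Ω) := by
    rw [← span_testPairs, ← Submodule.topologicalClosure_coe]
    exact hp
  exact hC.closure_subset_iff.2 h hp'

instance : CompleteSpace (H10 Ω) :=
  (Submodule.isClosed_topologicalClosure _).completeSpace_coe

/-- The embedding of `H¹₀(Ω)` into `L²(Ω)`. -/
noncomputable def embedding (Ω : Set (E d)) : H10 Ω →L[ℝ] L2 Ω :=
  (WithLp.fstL 2 ℝ (L2 Ω) (L2Vec Ω)).comp (H10 Ω).subtypeL

theorem embedding_apply (p : H10 Ω) : embedding Ω p = (p : WithLp 2 (L2 Ω × L2Vec Ω)).fst := rfl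

theorem inner_H10 (p q : H10 Ω) :
    ⟪p, q⟫ = ⟪embedding Ω p, embedding Ω q⟫ +
      ⟪(p : WithLp 2 (L2 Ω × L2Vec Ω)).snd, (q : WithLp 2 (L2 Ω × L2Vec Ω)).snd⟫ := by
  rw [Submodule.coe_inner, WithLp.prod_inner_apply]; rfl

theorem norm_sq_H10 (p : H10 Ω) :
    ‖p‖ ^ 2 = ‖embedding Ω p‖ ^ 2 + ‖(p : WithLp 2 (L2 Ω × L2Vec Ω)).snd‖ ^ 2 := by
  rw [← real_inner_self_eq_norm_sq, inner_H10, real_inner_self_eq_norm_sq,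
    real_inner_self_eq_norm_sq]

/-- The inner product of `H10 Ω` contains the L² product besides the Dirichlet form; this accounts
for the shift by 1. -/
theorem mem_dirichletEigenspace_of_inner {p : H10 Ω} {m : ℝ}
    (h : ∀ q : H10 Ω, ⟪p, q⟫ = m * ⟪embedding Ω p, embedding Ω q⟫) :
    embedding Ω p ∈ dirichletEigenspace Ω (m - 1) := by
  refine ⟨(p : WithLp 2 (L2 Ω × L2Vec Ω)).snd, p.2, fun q hq => ?_⟩
  have := h ⟨q, hq⟩
  rw [inner_H10] at this
  rw [real_inner_smul_left]
  simp only [embedding_apply] at this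
  rw [embedding_apply]
  linarith

theorem dirichletEigenspace_eq_bot_of_neg {t : ℝ} (ht : t < 0) : dirichletEigenspace Ω t = ⊥ := by
  rw [eq_bot_iff]
  rintro u ⟨g, hg, h⟩
  have h1 := h _ hg
  simp only [WithLp.toLp_snd, WithLp.toLp_fst] at h1
  rw [real_inner_smul_left, real_inner_self_eq_norm_sq, real_inner_self_eq_norm_sq] at h1
  have : ‖u‖ = 0 := by
    by_contra hu
    have : 0 < ‖u‖ ^ 2 := by positivity
    nlinarith [sq_nonneg ‖g‖]
  simpa using this

/-- An infimum in `ℝ` can be compared with its elements only if the set is bounded below. Here 0 is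
a lower bound because there are no negative eigenvalues; for `n = 0` every real number would
qualify. -/
theorem dirichletEigenvalue_le {n : ℕ} (hn : 1 ≤ n) {t : ℝ}
    (h : (n : Cardinal) ≤ countingFunction Ω t) : dirichletEigenvalue Ω n ≤ t := by
  refine csInf_le ⟨0, fun s hs => ?_⟩ h
  by_contra hneg
  push Not at hneg
  have hbot : (⨆ r ∈ Set.Iic s, dirichletEigenspace Ω r) = ⊥ := by
    simp only [iSup_eq_bot]
    intro r hr
    exact dirichletEigenspace_eq_bot_of_neg (lt_of_le_of_lt hr hneg)
  have hs' : (n : Cardinal) ≤ countingFunction Ω s := hs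
  rw [countingFunction, hbot, rank_bot] at hs'
  have : n = 0 := by exact_mod_cast le_antisymm hs' ((by simp))
  omega

theorem le_countingFunction {n : ℕ} {t : ℝ} {u : ℕ → L2 Ω} (h0 : ∀ i < n, u i ≠ 0)
    (horth : ∀ i < n, ∀ l < n, i ≠ l → ⟪u i, u l⟫ = 0)
    (hu : ∀ i < n, ∃ s ≤ t, u i ∈ dirichletEigenspace Ω s) :
    (n : Cardinal) ≤ countingFunction Ω t := by
  have hmem : ∀ i : Fin n, u i ∈ ⨆ s ∈ Set.Iic t, dirichletEigenspace Ω s := by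
    intro i
    obtain ⟨s, hs, hus⟩ := hu i i.2
    exact Submodule.mem_iSup_of_mem s (Submodule.mem_iSup_of_mem hs hus)
  have hli : LinearIndependent ℝ (fun i : Fin n => u i) :=
    linearIndependent_of_ne_zero_of_inner_eq_zero (𝕜 := ℝ) (fun i => h0 i i.2)
      fun i l hil => horth i i.2 l l.2 (fun h => hil (Fin.ext h))
  have hli' : LinearIndependent ℝ
      (fun i : Fin n => (⟨u i, hmem i⟩ : ↥(⨆ s ∈ Set.Iic t, dirichletEigenspace Ω s))) :=
    LinearIndependent.of_comp (Submodule.subtype _) hli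
  simpa using! hli'.cardinal_lift_le_rank

/-! ### Plancherel identities for test functions -/

open scoped FourierTransform

section Plancherel

variable {ψ : E d → ℝ}

/-- A real test function as a complex Schwartz function. -/
noncomputable def schwartzOfReal (hs : ContDiff ℝ ∞ ψ) (hc : HasCompactSupport ψ) :
    SchwartzMap (E d) ℂ :=
  HasCompactSupport.toSchwartzMap (f := fun x => (ψ x : ℂ))
    (hc.comp_left (g := ((↑) : ℝ → ℂ)) Complex.ofReal_zero)
    (Complex.ofRealCLM.contDiff.comp hs)

theorem schwartzOfReal_coe (hs : ContDiff ℝ ∞ ψ) (hc : HasCompactSupport ψ) :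
    (schwartzOfReal hs hc : E d → ℂ) = fun x => (ψ x : ℂ) := rfl

theorem integrable_norm_sq_schwartz (f : SchwartzMap (E d) ℂ) :
    Integrable (fun x => ‖f x‖ ^ 2) := by
  have := (f.memLp 2 volume).integrable_norm_pow (by norm_num)
  simpa using this

theorem integral_norm_sq_fourier_ofReal (hs : ContDiff ℝ ∞ ψ) (hc : HasCompactSupport ψ) :
    Integrable (fun ξ => ‖𝓕 (fun x => (ψ x : ℂ)) ξ‖ ^ 2) ∧
      ∫ ξ, ‖𝓕 (fun x => (ψ x : ℂ)) ξ‖ ^ 2 = ∫ x, ψ x ^ 2 := by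
  have h1 := integrable_norm_sq_schwartz (𝓕 (schwartzOfReal hs hc))
  have h2 := SchwartzMap.integral_norm_sq_fourier (schwartzOfReal hs hc)
  rw [SchwartzMap.fourier_coe, schwartzOfReal_coe] at h1 h2
  refine ⟨h1, h2.trans ?_⟩
  simp

theorem norm_sq_fourier_lineDeriv (f : SchwartzMap (E d) ℂ) (m ξ : E d) :
    ‖𝓕 (LineDeriv.lineDerivOp m f) ξ‖ ^ 2 = 4 * Real.pi ^ 2 * (⟪ξ, m⟫ ^ 2 * ‖𝓕 f ξ‖ ^ 2) := by
  have ht : Function.HasTemperateGrowth (fun x : E d => (⟪x, m⟫ : ℝ)) := by fun_prop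
  rw [SchwartzMap.fourier_lineDerivOp_eq, smul_apply,
    SchwartzMap.smulLeftCLM_apply_apply ht, norm_smul, norm_smul]
  simp only [norm_mul, Complex.norm_ofNat, Complex.norm_real, Complex.norm_I, mul_one,
    Real.norm_eq_abs, mul_pow, sq_abs]
  ring

theorem integral_norm_sq_mul_fourier_ofReal (hs : ContDiff ℝ ∞ ψ) (hc : HasCompactSupport ψ) :
    Integrable (fun ξ => ‖ξ‖ ^ 2 * ‖𝓕 (fun x => (ψ x : ℂ)) ξ‖ ^ 2) ∧
      4 * Real.pi ^ 2 * ∫ ξ, ‖ξ‖ ^ 2 * ‖𝓕 (fun x => (ψ x : ℂ)) ξ‖ ^ 2 = ∫ x, ‖∇ ψ x‖ ^ 2 := by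
  set f := schwartzOfReal hs hc with hf
  have hcoe : 𝓕 (fun x => (ψ x : ℂ)) = (𝓕 f : SchwartzMap (E d) ℂ) := by
    rw [SchwartzMap.fourier_coe, hf, schwartzOfReal_coe]
  rw [hcoe]
  let e : Fin d → E d := fun i => EuclideanSpace.single i 1
  have hin : ∀ (ξ : E d) (i : Fin d), ⟪ξ, e i⟫ = ξ i := fun ξ i => by
    simp [e, EuclideanSpace.inner_single_right]
  have hpi : (4 * Real.pi ^ 2) ≠ 0 := by positivity
  have h1 : ∀ i, Integrable (fun ξ => ξ i ^ 2 * ‖(𝓕 f : SchwartzMap (E d) ℂ) ξ‖ ^ 2) := fun i => by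
    have := integrable_norm_sq_schwartz (𝓕 (LineDeriv.lineDerivOp (e i) f))
    simp_rw [norm_sq_fourier_lineDeriv, hin] at this
    have h2 := this.const_mul (4 * Real.pi ^ 2)⁻¹
    simpa only [inv_mul_cancel_left₀ hpi] using h2
  have h2 : ∀ i, 4 * Real.pi ^ 2 * ∫ ξ, ξ i ^ 2 * ‖(𝓕 f : SchwartzMap (E d) ℂ) ξ‖ ^ 2 =
      ∫ x, (∇ ψ x) i ^ 2 := fun i => by
    have := SchwartzMap.integral_norm_sq_fourier (LineDeriv.lineDerivOp (e i) f)
    simp_rw [norm_sq_fourier_lineDeriv, hin] at this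
    rw [integral_const_mul] at this
    rw [this]
    refine integral_congr_ae (Eventually.of_forall fun x => ?_)
    have hd : HasFDerivAt (fun y => (ψ y : ℂ)) (Complex.ofRealCLM.comp (fderiv ℝ ψ x)) x :=
      Complex.ofRealCLM.hasFDerivAt.comp x (hs.differentiable (by simp) x).hasFDerivAt
    have h3 : (LineDeriv.lineDerivOp (e i) f) x = ((fderiv ℝ ψ x (e i) : ℝ) : ℂ) := by
      rw [SchwartzMap.lineDerivOp_apply_eq_fderiv, hf, schwartzOfReal_coe, hd.fderiv]
      rfl
    simp only
    rw [h3, Complex.norm_real, ← inner_gradient_left, hin, Real.norm_eq_abs, sq_abs]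
  have e1 : ∀ ξ : E d, ‖ξ‖ ^ 2 * ‖(𝓕 f : SchwartzMap (E d) ℂ) ξ‖ ^ 2 =
      ∑ i, ξ i ^ 2 * ‖(𝓕 f : SchwartzMap (E d) ℂ) ξ‖ ^ 2 := fun ξ => by
    rw [EuclideanSpace.norm_sq_eq, Finset.sum_mul]
    simp
  have e2 : ∀ x, ‖∇ ψ x‖ ^ 2 = ∑ i, (∇ ψ x) i ^ 2 := fun x => by
    rw [EuclideanSpace.norm_sq_eq]; simp
  have hgi : ∀ i, Integrable (fun x => (∇ ψ x) i ^ 2) := fun i => by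
    have hcont : Continuous fun x => (∇ ψ x) i ^ 2 := by
      have := continuous_gradient hs
      fun_prop
    refine hcont.integrable_of_hasCompactSupport ?_
    exact (hasCompactSupport_gradient hc).comp_left (g := fun v : E d => v i ^ 2) (by simp)
  refine ⟨?_, ?_⟩
  · simp_rw [e1]
    exact integrable_finsetSum _ fun i _ => h1 i
  · simp_rw [e1, e2]
    rw [integral_finsetSum _ fun i _ => h1 i, integral_finsetSum _ fun i _ => hgi i,
      Finset.mul_sum]
    exact Finset.sum_congr rfl fun i _ => h2 i

/-- Off the ball `1 ≤ ‖ξ‖² / R²`, so the high frequencies are controlled by the Plancherel identity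
for the gradient. -/
theorem integral_sq_le_fourier_ball_add (hs : ContDiff ℝ ∞ ψ) (hc : HasCompactSupport ψ)
    {R : ℝ} (hR : 0 < R) :
    ∫ x, ψ x ^ 2 ≤ (∫ ξ in Metric.closedBall 0 R, ‖𝓕 (fun x => (ψ x : ℂ)) ξ‖ ^ 2) +
      (4 * Real.pi ^ 2 * R ^ 2)⁻¹ * ∫ x, ‖∇ ψ x‖ ^ 2 := by
  obtain ⟨h1, h2⟩ := integral_norm_sq_fourier_ofReal hs hc
  obtain ⟨h3, h4⟩ := integral_norm_sq_mul_fourier_ofReal hs hc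
  set F : E d → ℝ := fun ξ => ‖𝓕 (fun x => (ψ x : ℂ)) ξ‖ ^ 2 with hF
  have hF0 : ∀ ξ, 0 ≤ F ξ := fun ξ => sq_nonneg _
  rw [← h2, ← h4, ← integral_add_compl (Metric.isClosed_closedBall (x := (0 : E d)) (ε := R)).measurableSet h1]
  gcongr
  have hpi : (Real.pi : ℝ) ≠ 0 := Real.pi_ne_zero
  have e : (4 * Real.pi ^ 2 * R ^ 2)⁻¹ * (4 * Real.pi ^ 2 * ∫ ξ, ‖ξ‖ ^ 2 * F ξ) =
      ∫ ξ, (R ^ 2)⁻¹ * (‖ξ‖ ^ 2 * F ξ) := by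
    rw [integral_const_mul]
    field_simp
  rw [e]
  refine le_trans (setIntegral_mono_on h1.integrableOn (h3.const_mul _).integrableOn
    Metric.isClosed_closedBall.measurableSet.compl fun ξ hξ => ?_)
    (setIntegral_le_integral (h3.const_mul _) (Eventually.of_forall fun ξ => ?_))
  · have hξ' : R ≤ ‖ξ‖ := by
      simp only [Set.mem_compl_iff, Metric.mem_closedBall, dist_zero_right, not_le] at hξ
      exact hξ.le
    have h5 : 1 ≤ (R ^ 2)⁻¹ * ‖ξ‖ ^ 2 := by
      rw [inv_mul_eq_div, one_le_div (by positivity)]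
      gcongr
    rw [← mul_assoc]
    exact le_mul_of_one_le_left (hF0 ξ) h5
  · have := hF0 ξ
    simp only [Pi.zero_apply]
    positivity

end Plancherel

/-! ### Real plane waves and Bessel's inequality -/

section Waves

/-- The wave `φ(x) g(2π ξ·x)`, where `g` is the cosine or the sine. -/
noncomputable def wave (φ : E d → ℝ) (g : ℝ → ℝ) (ξ : E d) : E d → ℝ :=
  fun x => φ x * g (2 * Real.pi * ⟪ξ, x⟫)

theorem continuous_wave {φ : E d → ℝ} {g : ℝ → ℝ} (hφ : Continuous φ) (hg : Continuous g)
    (ξ : E d) : Continuous (wave φ g ξ) := by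
  unfold wave
  fun_prop

theorem abs_wave_le {φ : E d → ℝ} {g : ℝ → ℝ} (hφ : ∀ x, |φ x| ≤ 1) (hg : ∀ t, |g t| ≤ 1)
    (ξ x : E d) : |wave φ g ξ x| ≤ 1 := by
  rw [wave, abs_mul]
  exact mul_le_one₀ (hφ x) (abs_nonneg _) (hg _)

theorem memLp_wave [IsFiniteMeasure (volume.restrict Ω)] {φ : E d → ℝ} {g : ℝ → ℝ}
    (hφ : Continuous φ) (hφ1 : ∀ x, |φ x| ≤ 1) (hg : Continuous g) (hg1 : ∀ t, |g t| ≤ 1)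
    (ξ : E d) : MemLp (wave φ g ξ) 2 (volume.restrict Ω) :=
  MemLp.of_bound (continuous_wave hφ hg ξ).aestronglyMeasurable 1
    (Eventually.of_forall fun x => abs_wave_le hφ1 hg1 ξ x)

/-- A wave as an element of `L²(Ω)`. -/
noncomputable def waveL2 {φ : E d → ℝ} {g : ℝ → ℝ}
    (h : ∀ ξ, MemLp (wave φ g ξ) 2 (volume.restrict Ω)) (ξ : E d) : L2 Ω := (h ξ).toLp _

theorem inner_waveL2 {φ : E d → ℝ} {g : ℝ → ℝ}
    (h : ∀ ξ, MemLp (wave φ g ξ) 2 (volume.restrict Ω)) (ξ : E d) {u : L2 Ω} {ψ : E d → ℝ}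
    (hu : ∀ᵐ x ∂(volume.restrict Ω), u x = ψ x) :
    ⟪waveL2 h ξ, u⟫ = ∫ x in Ω, wave φ g ξ x * ψ x := by
  rw [L2.inner_def]
  refine integral_congr_ae ?_
  filter_upwards [(h ξ).coeFn_toLp, hu] with x h1 h2
  rw [waveL2, h1, h2]
  simp [mul_comm]

/-- As `g` is 1-Lipschitz and `Ω` is bounded, the phase, and hence the wave in the sup norm on `Ω`,
is Lipschitz in ξ. This makes frequency integrals over balls meaningful and images of balls compact.
-/
theorem continuous_waveL2 [IsFiniteMeasure (volume.restrict Ω)] (hb : Bornology.IsBounded Ω)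
    (hm : MeasurableSet Ω) {φ : E d → ℝ} {g : ℝ → ℝ} (hφ1 : ∀ x, |φ x| ≤ 1)
    (hg : LipschitzWith 1 g) (h : ∀ ξ, MemLp (wave φ g ξ) 2 (volume.restrict Ω)) :
    Continuous (waveL2 h) := by
  obtain ⟨D, hD⟩ := hb.subset_closedBall 0
  obtain ⟨D', hD', hDD'⟩ : ∃ D' : ℝ, 0 ≤ D' ∧ D ≤ D' := ⟨max D 0, le_max_right _ _, le_max_left _ _⟩
  set m : ℝ := (measureUnivNNReal (volume.restrict Ω) : ℝ) ^ (2 : ENNReal).toReal⁻¹ with hmdef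
  have hm0 : 0 ≤ m := by positivity
  have hpi := Real.pi_pos
  refine (LipschitzWith.of_dist_le_mul (K := ⟨m * (2 * Real.pi * D'), by positivity⟩)
    fun ξ η => ?_).continuous
  rw [dist_eq_norm, dist_eq_norm]
  change _ ≤ m * (2 * Real.pi * D') * _
  rw [waveL2, waveL2, ← MemLp.toLp_sub, mul_assoc]
  refine Lp.norm_le_of_ae_bound (by positivity) ?_
  filter_upwards [((h ξ).sub (h η)).coeFn_toLp, ae_restrict_mem hm] with x hx hxΩ
  rw [hx, Pi.sub_apply, wave, wave, ← mul_sub, norm_mul]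
  have h1 := hg.norm_sub_le (2 * Real.pi * ⟪ξ, x⟫) (2 * Real.pi * ⟪η, x⟫)
  have hxD : ‖x‖ ≤ D' := by simpa using (hD hxΩ).trans hDD'
  calc ‖φ x‖ * ‖g (2 * Real.pi * ⟪ξ, x⟫) - g (2 * Real.pi * ⟪η, x⟫)‖
      ≤ 1 * (1 * ‖2 * Real.pi * ⟪ξ, x⟫ - 2 * Real.pi * ⟪η, x⟫‖) := by
        gcongr
        · exact hφ1 x
        · exact_mod_cast h1
    _ = 2 * Real.pi * |⟪ξ - η, x⟫| := by
        rw [← mul_sub, ← inner_sub_left, one_mul, one_mul, norm_mul, Real.norm_eq_abs,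
          Real.norm_eq_abs, abs_of_pos (by positivity)]
    _ ≤ 2 * Real.pi * (‖ξ - η‖ * D') := by
        gcongr
        exact (abs_real_inner_le_norm _ _).trans (by gcongr)
    _ = 2 * Real.pi * D' * ‖ξ - η‖ := by ring

variable {φ : E d → ℝ} (hc : ∀ ξ, MemLp (wave φ Real.cos ξ) 2 (volume.restrict Ω))
  (hs : ∀ ξ, MemLp (wave φ Real.sin ξ) 2 (volume.restrict Ω))

/-- The squared modulus of the Fourier transform of `φ u`. -/
noncomputable def fourierSq (u : L2 Ω) (ξ : E d) : ℝ :=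
  ⟪waveL2 hc ξ, u⟫ ^ 2 + ⟪waveL2 hs ξ, u⟫ ^ 2

/-- Cosine and sine waves produce the real part and minus the imaginary part of the Fourier
integral, so the argument can stay in real Hilbert spaces. -/
theorem fourierSq_eq {u : L2 Ω} {ψ : E d → ℝ} (hφ : ContDiff ℝ ∞ φ) (hψ : IsTest Ω ψ)
    (hu : ∀ᵐ x ∂(volume.restrict Ω), u x = ψ x) (ξ : E d) :
    fourierSq hc hs u ξ = ‖𝓕 (fun x => ((φ x * ψ x : ℝ) : ℂ)) ξ‖ ^ 2 := by
  have hint : Integrable (fun v => Complex.exp (↑(-2 * Real.pi * ⟪v, ξ⟫) * Complex.I) •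
      ((φ v * ψ v : ℝ) : ℂ)) := by
    have hcont : Continuous fun v => Complex.exp (↑(-2 * Real.pi * ⟪v, ξ⟫) * Complex.I) •
      ((φ v * ψ v : ℝ) : ℂ) := by
      have := hφ.continuous
      have := hψ.smooth.continuous
      fun_prop
    have hcs : HasCompactSupport fun v => ((φ v * ψ v : ℝ) : ℂ) :=
      (hψ.mul_left hφ).compact.comp_left (g := ((↑) : ℝ → ℂ)) Complex.ofReal_zero
    refine hcont.integrable_of_hasCompactSupport (hcs.mono fun v hv hv0 => hv ?_)
    simp only [hv0, smul_zero]
  have hout : ∀ (g : ℝ → ℝ), ∫ x in Ω, wave φ g ξ x * ψ x = ∫ x, wave φ g ξ x * ψ x := fun g =>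
    setIntegral_eq_integral_of_forall_compl_eq_zero fun x hx => by
      rw [hψ.eq_zero_of_notMem hx, mul_zero]
  have hexp : ∀ v : E d, Complex.exp (↑(-2 * Real.pi * ⟪v, ξ⟫) * Complex.I) =
      ((Real.cos (2 * Real.pi * ⟪ξ, v⟫) : ℝ) : ℂ) -
        ((Real.sin (2 * Real.pi * ⟪ξ, v⟫) : ℝ) : ℂ) * Complex.I := fun v => by
    rw [Complex.exp_mul_I, ← Complex.ofReal_cos, ← Complex.ofReal_sin, real_inner_comm v ξ,
      show -2 * Real.pi * ⟪v, ξ⟫ = -(2 * Real.pi * ⟪v, ξ⟫) by ring, Real.cos_neg, Real.sin_neg]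
    push_cast
    ring
  have hre : (𝓕 (fun x => ((φ x * ψ x : ℝ) : ℂ)) ξ).re = ⟪waveL2 hc ξ, u⟫ := by
    rw [inner_waveL2 hc ξ hu, hout, Real.fourier_eq']
    refine (Complex.reCLM.integral_comp_comm hint).symm.trans ?_
    refine integral_congr_ae (Eventually.of_forall fun v => ?_)
    simp only [hexp, wave, smul_eq_mul]
    generalize Real.cos _ = a
    generalize Real.sin _ = b
    simp
    ring
  have him : (𝓕 (fun x => ((φ x * ψ x : ℝ) : ℂ)) ξ).im = -⟪waveL2 hs ξ, u⟫ := by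
    rw [inner_waveL2 hs ξ hu, hout, Real.fourier_eq', ← integral_neg]
    refine (Complex.imCLM.integral_comp_comm hint).symm.trans ?_
    refine integral_congr_ae (Eventually.of_forall fun v => ?_)
    simp only [hexp, wave, smul_eq_mul]
    generalize Real.cos _ = a
    generalize Real.sin _ = b
    simp
    ring
  rw [Complex.sq_norm, Complex.normSq_apply, hre, him, fourierSq]
  ring

theorem continuous_fourierSq_right (u : L2 Ω) (h1 : Continuous (waveL2 hc))
    (h2 : Continuous (waveL2 hs)) : Continuous (fourierSq hc hs u) := by
  unfold fourierSq
  fun_prop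

/-- Dominated convergence with a bound uniform for v near u. The continuity makes the Fourier
inequalities closed conditions, which pass from test functions to H¹₀(Ω). -/
theorem continuous_integral_fourierSq (h1 : Continuous (waveL2 hc))
    (h2 : Continuous (waveL2 hs)) (R : ℝ) :
    Continuous fun u : L2 Ω => ∫ ξ in Metric.closedBall 0 R, fourierSq hc hs u ξ := by
  rw [continuous_iff_continuousAt]
  intro u
  have hev : ∀ᶠ v in 𝓝 u, ‖v‖ < ‖u‖ + 1 :=
    (continuous_norm.continuousAt (x := u)).eventually_lt_const (lt_add_one _)
  refine continuousAt_of_dominated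
    (bound := fun ξ => (‖waveL2 hc ξ‖ ^ 2 + ‖waveL2 hs ξ‖ ^ 2) * (‖u‖ + 1) ^ 2) ?_ ?_ ?_ ?_
  · exact Eventually.of_forall fun v =>
      (continuous_fourierSq_right hc hs v h1 h2).aestronglyMeasurable
  · filter_upwards [hev] with v hv
    refine Eventually.of_forall fun ξ => ?_
    have key : ∀ w : L2 Ω, ⟪w, v⟫ ^ 2 ≤ ‖w‖ ^ 2 * (‖u‖ + 1) ^ 2 := fun w => by
      rw [← mul_pow, ← sq_abs]
      gcongr
      exact (abs_real_inner_le_norm _ _).trans (by gcongr)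
    rw [Real.norm_eq_abs, fourierSq, abs_of_nonneg (by positivity), add_mul]
    exact add_le_add (key _) (key _)
  · refine ContinuousOn.integrableOn_compact (isCompact_closedBall _ _) ?_
    exact Continuous.continuousOn (by fun_prop)
  · refine Eventually.of_forall fun ξ => ?_
    unfold fourierSq
    fun_prop

/-- Bessel's inequality on a ball of frequencies. -/
theorem integral_fourierSq_le (hφ : ContDiff ℝ ∞ φ) (hφ1 : ∀ x, |φ x| ≤ 1)
    (h1 : Continuous (waveL2 hc)) (h2 : Continuous (waveL2 hs)) (R : ℝ) (p : H10 Ω) :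
    ∫ ξ in Metric.closedBall 0 R, fourierSq hc hs (embedding Ω p) ξ ≤ ‖embedding Ω p‖ ^ 2 := by
  refine H10_induction (C := {q : WithLp 2 (L2 Ω × L2Vec Ω) |
    ∫ ξ in Metric.closedBall 0 R, fourierSq hc hs q.fst ξ ≤ ‖q.fst‖ ^ 2}) ?_ ?_ p.1 p.2
  · have hf : Continuous fun q : WithLp 2 (L2 Ω × L2Vec Ω) => q.fst :=
      (WithLp.fstL 2 ℝ (L2 Ω) (L2Vec Ω)).continuous
    exact isClosed_le ((continuous_integral_fourierSq hc hs h1 h2 R).comp hf) (by fun_prop)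
  · rintro q ⟨ψ, k1, k2, k3, k4, -⟩
    have hψ : IsTest Ω ψ := ⟨k1, k2, k3⟩
    have hφψ := hψ.mul_left hφ
    obtain ⟨l1, l2⟩ := integral_norm_sq_fourier_ofReal hφψ.smooth hφψ.compact
    simp only [Set.mem_ofPred_eq]
    simp_rw [fourierSq_eq hc hs hφ hψ k4]
    refine (setIntegral_le_integral l1 (Eventually.of_forall fun ξ => sq_nonneg _)).trans ?_
    rw [l2, ← real_inner_self_eq_norm_sq, L2.inner_def]
    have e : ∫ x in Ω, ⟪q.fst x, q.fst x⟫ = ∫ x in Ω, ψ x ^ 2 :=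
      integral_congr_ae (by filter_upwards [k4] with x hx; rw [hx]; simp [sq])
    rw [e, setIntegral_eq_integral_of_forall_compl_eq_zero fun x hx => by
      rw [hψ.eq_zero_of_notMem hx]; ring]
    have hcs : HasCompactSupport (fun x => ψ x ^ 2) := k2.comp_left (g := fun t => t ^ 2) (by simp)
    refine integral_mono_of_nonneg (Eventually.of_forall fun x => sq_nonneg _)
      ((k1.continuous.pow 2).integrable_of_hasCompactSupport hcs) (Eventually.of_forall fun x => ?_)
    simp only
    rw [mul_pow]
    exact mul_le_of_le_one_left (sq_nonneg _) ((sq_le_one_iff_abs_le_one _).2 (hφ1 x))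

end Waves

/-! ### Rellich's theorem -/

theorem norm_sq_toLp_restrict {F : Type*} [NormedAddCommGroup F] [InnerProductSpace ℝ F]
    {u : Lp F 2 (volume.restrict Ω)} {f : E d → F} (hu : ∀ᵐ x ∂(volume.restrict Ω), u x = f x)
    (hf : ∀ x ∉ Ω, f x = 0) : ‖u‖ ^ 2 = ∫ x, ‖f x‖ ^ 2 := by
  have hout : ∫ x in Ω, ‖f x‖ ^ 2 = ∫ x, ‖f x‖ ^ 2 :=
    setIntegral_eq_integral_of_forall_compl_eq_zero fun x hx => by rw [hf x hx]; simp
  rw [← real_inner_self_eq_norm_sq, L2.inner_def, ← hout]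
  refine integral_congr_ae ?_
  filter_upwards [hu] with x hx
  rw [hx, real_inner_self_eq_norm_sq]

theorem IsTest.embedding_toH10_ae {φ : E d → ℝ} (h : IsTest Ω φ) :
    ∀ᵐ x ∂(volume.restrict Ω), embedding Ω h.toH10 x = φ x := h.memLp.coeFn_toLp

theorem IsTest.norm_sq_embedding {φ : E d → ℝ} (h : IsTest Ω φ) :
    ‖embedding Ω h.toH10‖ ^ 2 = ∫ x, φ x ^ 2 := by
  rw [norm_sq_toLp_restrict h.embedding_toH10_ae fun x hx => h.eq_zero_of_notMem hx]
  simp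

theorem IsTest.norm_sq_toH10 {φ : E d → ℝ} (h : IsTest Ω φ) :
    ‖h.toH10‖ ^ 2 = (∫ x, φ x ^ 2) + ∫ x, ‖∇ φ x‖ ^ 2 := by
  rw [norm_sq_H10, h.norm_sq_embedding]
  congr 1
  exact norm_sq_toLp_restrict h.memLp_gradient.coeFn_toLp
    fun x hx => h.gradient_eq_zero_of_notMem hx

/-- High frequencies of functions in `H¹₀(Ω)` are controlled by the gradient. -/
theorem norm_sq_embedding_le [IsFiniteMeasure (volume.restrict Ω)] (hb : Bornology.IsBounded Ω)
    (hm : MeasurableSet Ω) (hc : ∀ ξ, MemLp (wave 1 Real.cos ξ) 2 (volume.restrict Ω))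
    (hs : ∀ ξ, MemLp (wave 1 Real.sin ξ) 2 (volume.restrict Ω)) {R : ℝ} (hR : 0 < R)
    (p : H10 Ω) :
    ‖embedding Ω p‖ ^ 2 ≤
      (∫ ξ in Metric.closedBall 0 R, fourierSq hc hs (embedding Ω p) ξ) +
        (4 * Real.pi ^ 2 * R ^ 2)⁻¹ * ‖(p : WithLp 2 (L2 Ω × L2Vec Ω)).snd‖ ^ 2 := by
  have h1 := continuous_waveL2 hb hm (fun x => by simp) Real.lipschitzWith_cos hc
  have h2 := continuous_waveL2 hb hm (fun x => by simp) Real.lipschitzWith_sin hs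
  refine H10_induction (C := {q : WithLp 2 (L2 Ω × L2Vec Ω) | ‖q.fst‖ ^ 2 ≤
    (∫ ξ in Metric.closedBall 0 R, fourierSq hc hs q.fst ξ) +
        (4 * Real.pi ^ 2 * R ^ 2)⁻¹ * ‖q.snd‖ ^ 2}) ?_ ?_ p.1 p.2
  · have hf : Continuous fun q : WithLp 2 (L2 Ω × L2Vec Ω) => q.fst :=
      (WithLp.fstL 2 ℝ (L2 Ω) (L2Vec Ω)).continuous
    have hsn : Continuous fun q : WithLp 2 (L2 Ω × L2Vec Ω) => q.snd :=
      (WithLp.sndL 2 ℝ (L2 Ω) (L2Vec Ω)).continuous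
    have h3 := (continuous_integral_fourierSq hc hs h1 h2 R).comp hf
    simp only [Function.comp_def] at h3
    exact isClosed_le (by fun_prop) (by fun_prop)
  · rintro q ⟨ψ, k1, k2, k3, k4, k5⟩
    have hψ : IsTest Ω ψ := ⟨k1, k2, k3⟩
    simp only [Set.mem_ofPred_eq]
    have hone : ContDiff ℝ ∞ (1 : E d → ℝ) := contDiff_const
    simp_rw [fourierSq_eq hc hs hone hψ k4]
    rw [norm_sq_toLp_restrict k4 fun x hx => hψ.eq_zero_of_notMem hx,
      norm_sq_toLp_restrict k5 fun x hx => hψ.gradient_eq_zero_of_notMem hx]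
    have := integral_sq_le_fourier_ball_add k1 k2 hR
    simpa using this

/-- **Rellich's theorem**: `H¹₀(Ω)` embeds compactly into `L²(Ω)` if `Ω` is bounded. -/
theorem isCompactOperator_embedding (hb : Bornology.IsBounded Ω) (hm : MeasurableSet Ω) :
    IsCompactOperator (embedding Ω) := by
  have : IsFiniteMeasure (volume.restrict Ω) := ⟨by simpa using hb.measure_lt_top⟩
  have hc : ∀ ξ, MemLp (wave 1 Real.cos ξ) 2 (volume.restrict Ω) :=
    memLp_wave continuous_const (fun x => by simp) Real.continuous_cos Real.abs_cos_le_one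
  have hs : ∀ ξ, MemLp (wave 1 Real.sin ξ) 2 (volume.restrict Ω) :=
    memLp_wave continuous_const (fun x => by simp) Real.continuous_sin Real.abs_sin_le_one
  have h1 := continuous_waveL2 hb hm (fun x => by simp) Real.lipschitzWith_cos hc
  have h2 := continuous_waveL2 hb hm (fun x => by simp) Real.lipschitzWith_sin hs
  refine isCompactOperator_of_small_on_finite_codim fun ε hε => ?_
  -- R handles the high frequencies and τ the low ones: low frequencies will contribute at most
  -- `‖u‖² / 2`, and absorbing this on the left costs the factor 2 in front of the gradient term.
  obtain ⟨R, hR, hRε⟩ : ∃ R : ℝ, 0 < R ∧ 2 * (4 * Real.pi ^ 2 * R ^ 2)⁻¹ ≤ ε ^ 2 := by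
    refine ⟨ε⁻¹, inv_pos.2 hε, ?_⟩
    have h3 : (1 : ℝ) ≤ Real.pi ^ 2 := one_le_pow₀ (by linarith [Real.pi_gt_three])
    rw [inv_pow, mul_inv, inv_inv]
    have h4 : (4 * Real.pi ^ 2)⁻¹ ≤ 1 / 4 := by
      rw [inv_eq_one_div]
      exact one_div_le_one_div_of_le (by norm_num) (by linarith)
    nlinarith [sq_nonneg ε]
  set B : Set (E d) := Metric.closedBall 0 R with hB
  have hBfin : volume B ≠ ⊤ := measure_closedBall_lt_top.ne
  set v : ℝ := volume.real B with hv
  have hv0 : 0 ≤ v := measureReal_nonneg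
  obtain ⟨τ, hτ, hτv⟩ : ∃ τ : ℝ, 0 < τ ∧ 2 * τ ^ 2 * v ≤ 1 / 2 := by
    refine ⟨min 1 (1 / (4 * (v + 1))), by positivity, ?_⟩
    have h3 : min 1 (1 / (4 * (v + 1))) ≤ 1 := min_le_left _ _
    have h4 : min 1 (1 / (4 * (v + 1))) ≤ 1 / (4 * (v + 1)) := min_le_right _ _
    have h5 : 0 < min 1 (1 / (4 * (v + 1))) := by positivity
    have h6 : min 1 (1 / (4 * (v + 1))) ^ 2 ≤ 1 / (4 * (v + 1)) := by nlinarith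
    have h7 : 1 / (4 * (v + 1)) * v ≤ 1 / 4 := by
      rw [div_mul_eq_mul_div, div_le_div_iff₀ (by positivity) (by norm_num)]
      linarith
    nlinarith
  have hcomp1 := (isCompact_closedBall (0 : E d) R).image h1
  have hcomp2 := (isCompact_closedBall (0 : E d) R).image h2
  -- Waves with frequency in the ball form a compact subset of L²(Ω). If `u` is orthogonal to a
  -- finite τ-net of it, each of its low-frequency coefficients is at most `τ ‖u‖`.
  obtain ⟨F1, hF1, hF1'⟩ := Metric.totallyBounded_iff.1 hcomp1.totallyBounded τ hτ
  obtain ⟨F2, hF2, hF2'⟩ := Metric.totallyBounded_iff.1 hcomp2.totallyBounded τ hτ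
  refine ⟨F1 ∪ F2, hF1.union hF2, fun p hp => ?_⟩
  set u := embedding Ω p with hu
  have key : ∀ (F : Set (L2 Ω)) (w : L2 Ω), (∀ f ∈ F, ⟪f, u⟫ = 0) → w ∈ ⋃ y ∈ F, Metric.ball y τ →
      ⟪w, u⟫ ^ 2 ≤ τ ^ 2 * ‖u‖ ^ 2 := by
    intro F w hF hw
    simp only [Set.mem_iUnion, Metric.mem_ball, exists_prop] at hw
    obtain ⟨f, hf, hwf⟩ := hw
    have e : ⟪w, u⟫ = ⟪w - f, u⟫ := by rw [inner_sub_left, hF f hf, sub_zero]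
    rw [e, ← mul_pow, ← sq_abs]
    gcongr
    refine (abs_real_inner_le_norm _ _).trans ?_
    gcongr
    rw [← dist_eq_norm]
    exact hwf.le
  have hint : ∫ ξ in B, fourierSq hc hs u ξ ≤ 1 / 2 * ‖u‖ ^ 2 := by
    calc ∫ ξ in B, fourierSq hc hs u ξ ≤ ∫ ξ in B, 2 * τ ^ 2 * ‖u‖ ^ 2 := by
          refine setIntegral_mono_on ((continuous_fourierSq_right hc hs u h1
            h2).continuousOn.integrableOn_compact (isCompact_closedBall _ _))
            (integrableOn_const hBfin) Metric.isClosed_closedBall.measurableSet fun ξ hξ => ?_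
          have a1 := key F1 _ (fun f hf => hp f (Or.inl hf)) (hF1' ⟨ξ, hξ, rfl⟩)
          have a2 := key F2 _ (fun f hf => hp f (Or.inr hf)) (hF2' ⟨ξ, hξ, rfl⟩)
          rw [fourierSq]
          linarith
      _ = 2 * τ ^ 2 * v * ‖u‖ ^ 2 := by
          rw [setIntegral_const, smul_eq_mul]; ring
      _ ≤ 1 / 2 * ‖u‖ ^ 2 := by gcongr
  have hmain := norm_sq_embedding_le hb hm hc hs hR p
  rw [← hB, ← hu] at hmain
  have hle : ‖u‖ ^ 2 ≤ (ε * ‖p‖) ^ 2 := by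
    have h3 : ‖(p : WithLp 2 (L2 Ω × L2Vec Ω)).snd‖ ^ 2 ≤ ‖p‖ ^ 2 := by
      rw [norm_sq_H10]; linarith [sq_nonneg ‖embedding Ω p‖]
    calc ‖u‖ ^ 2 ≤ 2 * (4 * Real.pi ^ 2 * R ^ 2)⁻¹ *
          ‖(p : WithLp 2 (L2 Ω × L2Vec Ω)).snd‖ ^ 2 := by linarith
      _ ≤ ε ^ 2 * ‖p‖ ^ 2 := by gcongr
      _ = (ε * ‖p‖) ^ 2 := by ring
  exact (sq_le_sq₀ (norm_nonneg _) (by positivity)).1 hle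

/-! ### Eigenfunctions of the Dirichlet Laplacian -/

theorem exists_disjoint_tests (hd : 0 < d) (hopen : IsOpen Ω) (hne : Ω.Nonempty) :
    ∃ ψ : ℕ → E d → ℝ, (∀ n, IsTest Ω (ψ n)) ∧ (∀ n, ∃ x ∈ Ω, ψ n x ≠ 0) ∧
      ∀ n m, n ≠ m → ∀ x, ψ n x * ψ m x = 0 := by
  have : Nonempty (Fin d) := ⟨⟨0, hd⟩⟩
  obtain ⟨x₀, hx₀⟩ := hne
  have : (𝓝[≠] x₀).NeBot := Module.punctured_nhds_neBot ℝ (E d) x₀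
  -- For `d > 0` no point is isolated, so Ω is infinite; an infinite Hausdorff space contains a
  -- sequence of disjoint nonempty open sets.
  have : Infinite Ω := (infinite_of_mem_nhds x₀ (hopen.mem_nhds hx₀)).to_subtype
  obtain ⟨U, hU1, hU2, hU3⟩ := exists_seq_infinite_isOpen_pairwise_disjoint Ω
  choose y hy using fun n => (hU1 n).nonempty
  have hop : ∀ n, IsOpen (Subtype.val '' U n : Set (E d)) := fun n =>
    hopen.isOpenMap_subtype_val _ (hU2 n)
  have hbump := fun n => exists_contDiff_tsupport_subset (n := (⊤ : ℕ∞))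
    ((hop n).mem_nhds ⟨y n, hy n, rfl⟩)
  choose ψ h1 h2 h3 h4 h5 using hbump
  refine ⟨ψ, fun n => ⟨h3 n, h2 n, (h1 n).trans ?_⟩, fun n => ⟨y n, (y n).2, ?_⟩, ?_⟩
  · rintro _ ⟨z, -, rfl⟩
    exact z.2
  · rw [h5]; norm_num
  · intro n m hnm x
    by_contra hne
    obtain ⟨a, b⟩ := mul_ne_zero_iff.1 hne
    obtain ⟨z, hz, rfl⟩ := h1 n (subset_tsupport _ a)
    obtain ⟨w, hw, hwz⟩ := h1 m (subset_tsupport _ b)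
    rw [Subtype.val_injective hwz] at hw
    exact Set.disjoint_left.1 (hU3 hnm) hz hw

/-- The k orthogonality conditions have a nontrivial solution in the span of k + 1 test functions
with disjoint supports, and these stay independent in L²(Ω). -/
theorem exists_orthogonal_embedding_ne_zero (hd : 0 < d) (hopen : IsOpen Ω) (hne : Ω.Nonempty)
    (k : ℕ) (q : ℕ → H10 Ω) :
    ∃ x : H10 Ω, (∀ i < k, ⟪q i, x⟫ = 0) ∧ embedding Ω x ≠ 0 := by
  obtain ⟨ψ, h1, h2, h3⟩ := exists_disjoint_tests hd hopen hne
  let p : Fin (k + 1) → H10 Ω := fun n => (h1 n).toH10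
  have hli : LinearIndependent ℝ (fun n => embedding Ω (p n)) := by
    refine linearIndependent_of_ne_zero_of_inner_eq_zero (𝕜 := ℝ) (fun n h0 => ?_) ?_
    · obtain ⟨x, hx, hne⟩ := h2 n
      apply hne
      have hae : ψ n =ᵐ[volume.restrict Ω] (fun _ => (0 : ℝ)) := by
        filter_upwards [(h1 n).embedding_toH10_ae, Lp.coeFn_zero ℝ 2 (volume.restrict Ω)]
          with z hz hz0
        rw [← hz]
        change (embedding Ω (p n)) z = 0
        rw [h0, hz0]
        rfl
      exact Measure.eqOn_open_of_ae_eq hae hopen (h1 n).smooth.continuous.continuousOn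
        continuousOn_const hx
    · intro n m hnm
      rw [L2.inner_def]
      refine (integral_congr_ae ?_).trans (integral_zero _ _)
      filter_upwards [(h1 n).embedding_toH10_ae, (h1 m).embedding_toH10_ae] with z hz hz'
      change ⟪(embedding Ω (h1 n).toH10) z, (embedding Ω (h1 m).toH10) z⟫ = 0
      rw [hz, hz']
      have := h3 m n (fun h => hnm (Fin.ext h.symm)) z
      simpa using this
  let L : (Fin (k + 1) → ℝ) →ₗ[ℝ] (Fin k → ℝ) :=
    (LinearMap.pi fun i : Fin k => (innerSL ℝ (q i) : H10 Ω →L[ℝ] ℝ).toLinearMap).comp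
      (Fintype.linearCombination ℝ p)
  have hker : LinearMap.ker L ≠ ⊥ := LinearMap.ker_ne_bot_of_finrank_lt (by simp)
  obtain ⟨c, hc, hc0⟩ := (Submodule.ne_bot_iff _).1 hker
  refine ⟨Fintype.linearCombination ℝ p c, fun i hi => ?_, fun h0 => hc0 ?_⟩
  · exact congrFun (LinearMap.mem_ker.1 hc) ⟨i, hi⟩
  · rw [Fintype.linearCombination_apply, map_sum] at h0
    simp_rw [map_smul] at h0
    exact funext (Fintype.linearIndependent_iff.1 hli c h0)

/-- The averaged variational principle for the Dirichlet eigenvalues. -/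
theorem exists_dirichlet_eigenfunctions (hd : 0 < d) (hopen : IsOpen Ω) (hne : Ω.Nonempty)
    (hb : Bornology.IsBounded Ω) (k : ℕ) :
    ∃ (q : ℕ → H10 Ω) (M : ℕ → ℝ),
      (∀ i < k + 1, ‖embedding Ω (q i)‖ = 1) ∧
      (∀ i < k + 1, M i ≤ M k) ∧
      (∀ i < k + 1, dirichletEigenvalue Ω (i + 1) ≤ M i - 1) ∧
      ∀ x, M k * ‖embedding Ω x‖ ^ 2 - ‖x‖ ^ 2 ≤
        ∑ i ∈ Finset.range (k + 1), (M k - M i) * ⟪embedding Ω (q i), embedding Ω x⟫ ^ 2 := by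
  obtain ⟨q, M, h1, h2, h3, h4, h5⟩ := exists_eigenvectors_averaged
    (isCompactOperator_embedding hb hopen.measurableSet)
    (exists_orthogonal_embedding_ne_zero hd hopen hne) k
  refine ⟨q, M, h1, fun i hi => h4 k (Nat.lt_succ_self k) i (Nat.lt_succ_iff.1 hi), ?_, h5⟩
  intro i hi
  -- Indices of `q` start at 0: `q 0, …, q i` are `i + 1` orthonormal eigenfunctions with
  -- eigenvalues at most `M i - 1`.
  refine dirichletEigenvalue_le (by omega) (le_countingFunction (u := fun l => embedding Ω (q l))
    (fun l hl h0 => ?_) (fun l hl m hm hlm => h2 l (by omega) m (by omega) hlm) fun l hl => ?_)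
  · have := h1 l (by omega)
    rw [h0, norm_zero] at this
    exact zero_ne_one this
  · exact ⟨M l - 1, by linarith [h4 i hi l (by omega)],
      mem_dirichletEigenspace_of_inner (h3 l (by omega))⟩

/-! ### Volume and second moment of balls -/

theorem ballVolume_pos (d : ℕ) : 0 < ballVolume d :=
  div_pos (Real.rpow_pos_of_pos Real.pi_pos _) (Real.Gamma_pos_of_pos (by positivity))

theorem volume_real_ball_one (hd : 0 < d) :
    volume.real (Metric.ball (0 : E d) 1) = ballVolume d := by
  have : Nonempty (Fin d) := ⟨⟨0, hd⟩⟩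
  have h0 := (ballVolume_pos d).le
  rw [measureReal_def, EuclideanSpace.volume_ball]
  simp only [ENNReal.ofReal_one, one_pow, one_mul, Fintype.card_fin]
  have e : √Real.pi ^ d / Real.Gamma ((d : ℝ) / 2 + 1) = ballVolume d := by
    rw [ballVolume, add_comm, Real.sqrt_eq_rpow, ← Real.rpow_mul_natCast Real.pi_pos.le]
    congr 2
    ring
  rw [e, ENNReal.toReal_ofReal h0]

theorem volume_real_closedBall_zero (hd : 0 < d) {ρ : ℝ} (hρ : 0 ≤ ρ) :
    volume.real (Metric.closedBall (0 : E d) ρ) = ballVolume d * ρ ^ d := by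
  rw [measureReal_def, Measure.addHaar_closedBall _ _ hρ, ENNReal.toReal_mul,
    ENNReal.toReal_ofReal (by positivity), finrank_euclideanSpace_fin, mul_comm,
    ← measureReal_def, volume_real_ball_one hd]

theorem integral_closedBall_norm_sq (hd : 0 < d) {ρ : ℝ} (hρ : 0 ≤ ρ) :
    ∫ ξ in Metric.closedBall (0 : E d) ρ, ‖ξ‖ ^ 2 =
      (d : ℝ) / (d + 2) * ρ ^ 2 * (ballVolume d * ρ ^ d) := by
  have : Nonempty (Fin d) := ⟨⟨0, hd⟩⟩
  have : Nontrivial (E d) := inferInstance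
  set f : ℝ → ℝ := (Set.Iic ρ).indicator fun y => y ^ 2 with hf
  have e1 : ∫ ξ in Metric.closedBall (0 : E d) ρ, ‖ξ‖ ^ 2 = ∫ ξ : E d, f ‖ξ‖ := by
    rw [← integral_indicator Metric.isClosed_closedBall.measurableSet]
    refine integral_congr_ae (Eventually.of_forall fun ξ => ?_)
    by_cases hξ : ‖ξ‖ ≤ ρ
    · simp [hf, hξ, Metric.mem_closedBall]
    · simp [hf, hξ, Metric.mem_closedBall]
  have e2 : ∫ y in Set.Ioi (0 : ℝ), y ^ (d - 1) • f y = ρ ^ (d + 2) / (d + 2) := by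
    have e3 : ∀ y, y ^ (d - 1) • f y = (Set.Iic ρ).indicator (fun y => y ^ (d + 1)) y := by
      intro y
      rw [hf, smul_eq_mul]
      by_cases hy : y ∈ Set.Iic ρ
      · rw [Set.indicator_of_mem hy, Set.indicator_of_mem hy, ← pow_add]
        congr 1
        omega
      · rw [Set.indicator_of_notMem hy, Set.indicator_of_notMem hy, mul_zero]
    simp_rw [e3]
    rw [setIntegral_indicator measurableSet_Iic, Set.Ioi_inter_Iic,
      ← intervalIntegral.integral_of_le hρ, integral_pow]
    rw [zero_pow (by omega), sub_zero]
    push_cast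
    congr 1
    ring
  rw [e1, integral_fun_norm_addHaar, finrank_euclideanSpace_fin, e2, volume_real_ball_one hd,
    nsmul_eq_mul, smul_eq_mul, pow_add]
  field_simp

/-! ### Cut-off plane waves as trial functions -/

theorem contDiff_wave {φ : E d → ℝ} {g : ℝ → ℝ} (hφ : ContDiff ℝ ∞ φ) (hg : ContDiff ℝ ∞ g)
    (ξ : E d) : ContDiff ℝ ∞ (wave φ g ξ) := by
  unfold wave
  exact hφ.mul (hg.comp (contDiff_const.mul (contDiff_const.inner ℝ contDiff_id)))

theorem IsTest.wave {φ : E d → ℝ} {g : ℝ → ℝ} (h : IsTest Ω φ) (hg : ContDiff ℝ ∞ g) (ξ : E d) :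
    IsTest Ω (wave φ g ξ) :=
  ⟨contDiff_wave h.smooth hg ξ, h.compact.mul_right, (tsupport_mul_subset_left).trans h.supp⟩

theorem gradient_wave {φ : E d → ℝ} {g : ℝ → ℝ} {x ξ : E d} {g' : ℝ}
    (hφ : DifferentiableAt ℝ φ x) (hg : HasDerivAt g g' (2 * Real.pi * ⟪ξ, x⟫)) :
    ∇ (wave φ g ξ) x =
      g (2 * Real.pi * ⟪ξ, x⟫) • ∇ φ x + (2 * Real.pi * φ x * g') • ξ := by
  have h1 : HasFDerivAt (fun y : E d => 2 * Real.pi * ⟪ξ, y⟫)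
      ((2 * Real.pi) • (innerSL ℝ ξ : E d →L[ℝ] ℝ)) x :=
    (innerSL ℝ ξ : E d →L[ℝ] ℝ).hasFDerivAt.const_mul (2 * Real.pi)
  have h2 := hφ.hasFDerivAt.mul (hg.comp_hasFDerivAt x h1)
  have h3 : fderiv ℝ (wave φ g ξ) x = _ := h2.fderiv
  refine ext_inner_right ℝ fun v => ?_
  rw [inner_gradient_left, h3, inner_add_left, real_inner_smul_left, real_inner_smul_left,
    inner_gradient_left]
  simp
  ring

/-- The cross terms between `∇ φ` and ξ have opposite signs for cosine and sine and cancel. -/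
theorem norm_sq_gradient_wave_add {φ : E d → ℝ} {x : E d} (ξ : E d)
    (hφ : DifferentiableAt ℝ φ x) :
    ‖∇ (wave φ Real.cos ξ) x‖ ^ 2 + ‖∇ (wave φ Real.sin ξ) x‖ ^ 2 =
      ‖∇ φ x‖ ^ 2 + 4 * Real.pi ^ 2 * ‖ξ‖ ^ 2 * φ x ^ 2 := by
  rw [gradient_wave hφ (Real.hasDerivAt_cos _), gradient_wave hφ (Real.hasDerivAt_sin _),
    norm_add_sq_real, norm_add_sq_real]
  simp only [norm_smul, real_inner_smul_left, real_inner_smul_right, mul_pow, Real.norm_eq_abs,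
    sq_abs]
  have := Real.sin_sq_add_cos_sq (2 * Real.pi * ⟪ξ, x⟫)
  linear_combination (‖∇ φ x‖ ^ 2 + 4 * Real.pi ^ 2 * ‖ξ‖ ^ 2 * φ x ^ 2) * this

theorem integrable_sq_of_test {φ : E d → ℝ} (h : IsTest Ω φ) : Integrable (fun x => φ x ^ 2) :=
  (h.smooth.continuous.pow 2).integrable_of_hasCompactSupport
    (h.compact.mono fun x hx h0 => hx (by
      change φ x ^ 2 = 0
      rw [h0, sq, mul_zero]))

theorem integrable_norm_sq_gradient_of_test {φ : E d → ℝ} (h : IsTest Ω φ) :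
    Integrable (fun x => ‖∇ φ x‖ ^ 2) :=
  ((continuous_gradient h.smooth).norm.pow 2).integrable_of_hasCompactSupport
    ((hasCompactSupport_gradient h.compact).mono fun x hx h0 => hx (by
      change ‖∇ φ x‖ ^ 2 = 0
      rw [h0, norm_zero, sq, mul_zero]))

theorem norm_sq_embedding_wave_add {φ : E d → ℝ} (h : IsTest Ω φ) (ξ : E d) :
    ‖embedding Ω (h.wave Real.contDiff_cos ξ).toH10‖ ^ 2 +
      ‖embedding Ω (h.wave Real.contDiff_sin ξ).toH10‖ ^ 2 = ∫ x, φ x ^ 2 := by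
  rw [IsTest.norm_sq_embedding, IsTest.norm_sq_embedding,
    ← integral_add (integrable_sq_of_test (h.wave Real.contDiff_cos ξ))
      (integrable_sq_of_test (h.wave Real.contDiff_sin ξ))]
  refine integral_congr_ae (Eventually.of_forall fun x => ?_)
  simp only [wave]
  linear_combination φ x ^ 2 * Real.sin_sq_add_cos_sq (2 * Real.pi * ⟪ξ, x⟫)

theorem norm_sq_toH10_wave_add {φ : E d → ℝ} (h : IsTest Ω φ) (ξ : E d) :
    ‖(h.wave Real.contDiff_cos ξ).toH10‖ ^ 2 + ‖(h.wave Real.contDiff_sin ξ).toH10‖ ^ 2 =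
      (1 + 4 * Real.pi ^ 2 * ‖ξ‖ ^ 2) * (∫ x, φ x ^ 2) + ∫ x, ‖∇ φ x‖ ^ 2 := by
  have h1 := norm_sq_embedding_wave_add h ξ
  rw [IsTest.norm_sq_embedding, IsTest.norm_sq_embedding] at h1
  have h2 : (∫ x, ‖∇ (wave φ Real.cos ξ) x‖ ^ 2) + ∫ x, ‖∇ (wave φ Real.sin ξ) x‖ ^ 2 =
      (∫ x, ‖∇ φ x‖ ^ 2) + 4 * Real.pi ^ 2 * ‖ξ‖ ^ 2 * ∫ x, φ x ^ 2 := by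
    rw [← integral_add (integrable_norm_sq_gradient_of_test (h.wave Real.contDiff_cos ξ))
      (integrable_norm_sq_gradient_of_test (h.wave Real.contDiff_sin ξ)), ← integral_const_mul,
      ← integral_add (integrable_norm_sq_gradient_of_test h)
        ((integrable_sq_of_test h).const_mul _)]
    exact integral_congr_ae (Eventually.of_forall fun x =>
      norm_sq_gradient_wave_add ξ (h.smooth.differentiable (by simp) x))
  rw [IsTest.norm_sq_toH10, IsTest.norm_sq_toH10]
  linarith

/-- Upper bound for eigenvalue sums, with the plane waves `φ(x) e^{2πi ξ·x}` as trial functions. -/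
theorem sum_dirichletEigenvalue_le (hd : 0 < d) (hopen : IsOpen Ω) (hne : Ω.Nonempty)
    (hb : Bornology.IsBounded Ω) {φ : E d → ℝ} (h : IsTest Ω φ) (hφ1 : ∀ x, |φ x| ≤ 1)
    (hA : 0 < ∫ x, φ x ^ 2) {n : ℕ} (hn : 1 ≤ n) :
    ∑ j ∈ Finset.Icc 1 n, dirichletEigenvalue Ω j ≤
      n * ((d : ℝ) / (d + 2) * classicalConst d * (n / ∫ x, φ x ^ 2) ^ (2 / (d : ℝ)) +
        (∫ x, ‖∇ φ x‖ ^ 2) / ∫ x, φ x ^ 2) := by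
  obtain ⟨k, rfl⟩ : ∃ k, n = k + 1 := ⟨n - 1, by omega⟩
  obtain ⟨q, M, h1, h2, h3, h4⟩ := exists_dirichlet_eigenfunctions hd hopen hne hb k
  have : IsFiniteMeasure (volume.restrict Ω) := ⟨by simpa using hb.measure_lt_top⟩
  set A : ℝ := ∫ x, φ x ^ 2 with hAdef
  set B : ℝ := ∫ x, ‖∇ φ x‖ ^ 2 with hBdef
  have hc : ∀ ξ, MemLp (wave φ Real.cos ξ) 2 (volume.restrict Ω) :=
    fun ξ => (h.wave Real.contDiff_cos ξ).memLp
  have hs : ∀ ξ, MemLp (wave φ Real.sin ξ) 2 (volume.restrict Ω) :=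
    fun ξ => (h.wave Real.contDiff_sin ξ).memLp
  have k1 := continuous_waveL2 hb hopen.measurableSet hφ1 Real.lipschitzWith_cos hc
  have k2 := continuous_waveL2 hb hopen.measurableSet hφ1 Real.lipschitzWith_sin hs
  -- The variational inequality is added for the cosine and the sine wave; the `-1` comes from the
  -- L² part of the norm of `H10 Ω`.
  have hpt : ∀ ξ : E d, (M k - 1) * A - B - 4 * Real.pi ^ 2 * A * ‖ξ‖ ^ 2 ≤
      ∑ i ∈ Finset.range (k + 1), (M k - M i) * fourierSq hc hs (embedding Ω (q i)) ξ := by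
    intro ξ
    have a1 := h4 (h.wave Real.contDiff_cos ξ).toH10
    have a2 := h4 (h.wave Real.contDiff_sin ξ).toH10
    have a3 := norm_sq_embedding_wave_add h ξ
    have a4 := norm_sq_toH10_wave_add h ξ
    have e : ∑ i ∈ Finset.range (k + 1), (M k - M i) * fourierSq hc hs (embedding Ω (q i)) ξ =
        (∑ i ∈ Finset.range (k + 1), (M k - M i) *
          ⟪embedding Ω (q i), embedding Ω (h.wave Real.contDiff_cos ξ).toH10⟫ ^ 2) +
        ∑ i ∈ Finset.range (k + 1), (M k - M i) *
          ⟪embedding Ω (q i), embedding Ω (h.wave Real.contDiff_sin ξ).toH10⟫ ^ 2 := by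
      rw [← Finset.sum_add_distrib]
      refine Finset.sum_congr rfl fun i _ => ?_
      rw [← mul_add, fourierSq, real_inner_comm (embedding Ω (q i)),
        real_inner_comm (embedding Ω (q i))]
      rfl
    rw [e]
    have a5 : M k * ‖embedding Ω (h.wave Real.contDiff_cos ξ).toH10‖ ^ 2 +
      M k * ‖embedding Ω (h.wave Real.contDiff_sin ξ).toH10‖ ^ 2 = M k * A := by
        rw [← mul_add, a3]
    linarith
  set w := ballVolume d with hw
  have hw0 : 0 < w := ballVolume_pos d
  have hdR : (0 : ℝ) < d := by exact_mod_cast hd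
  set N : ℝ := ((k + 1 : ℕ) : ℝ) with hN
  have hN0 : 0 < N := by rw [hN]; positivity
  -- With this radius the ball has volume `N / A`, so `M k` gets the same total weight on both sides
  -- after integration and cancels: nothing need be known about it.
  set ρ : ℝ := (N / A / w) ^ (1 / (d : ℝ)) with hρ
  have hρ0 : 0 ≤ ρ := by positivity
  have hρd : w * ρ ^ d * A = N := by
    rw [hρ, ← Real.rpow_mul_natCast (by positivity), one_div_mul_cancel hdR.ne', Real.rpow_one]
    field_simp
  have hρ2 : 4 * Real.pi ^ 2 * ρ ^ 2 = classicalConst d * (N / A) ^ (2 / (d : ℝ)) := by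
    rw [hρ, ← Real.rpow_mul_natCast (by positivity), classicalConst, ← hw,
      Real.div_rpow (by positivity) hw0.le, Real.rpow_neg hw0.le]
    have e : (1 / (d : ℝ) * (2 : ℕ)) = 2 / d := by push_cast; ring
    rw [e]
    ring
  have hvol := volume_real_closedBall_zero hd hρ0
  have hnorm2 := integral_closedBall_norm_sq hd hρ0
  have hcomp := isCompact_closedBall (0 : E d) ρ
  have hcontL : Continuous fun ξ : E d => (M k - 1) * A - B - 4 * Real.pi ^ 2 * A * ‖ξ‖ ^ 2 := by
    fun_prop
  have hcontF : ∀ i, Continuous (fourierSq hc hs (embedding Ω (q i))) := fun i =>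
    continuous_fourierSq_right hc hs _ k1 k2
  have hintF : ∀ i, IntegrableOn (fun ξ => (M k - M i) * fourierSq hc hs (embedding Ω (q i)) ξ)
      (Metric.closedBall 0 ρ) := fun i =>
    ((hcontF i).const_mul _).continuousOn.integrableOn_compact hcomp
  have hmono : ∫ ξ in Metric.closedBall (0 : E d) ρ,
        ((M k - 1) * A - B - 4 * Real.pi ^ 2 * A * ‖ξ‖ ^ 2) ≤
      ∫ ξ in Metric.closedBall (0 : E d) ρ,
        ∑ i ∈ Finset.range (k + 1), (M k - M i) * fourierSq hc hs (embedding Ω (q i)) ξ :=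
    setIntegral_mono_on (hcontL.continuousOn.integrableOn_compact hcomp)
      (integrable_finsetSum _ fun i _ => hintF i) Metric.isClosed_closedBall.measurableSet
      fun ξ _ => hpt ξ
  have hleft : ∫ ξ in Metric.closedBall (0 : E d) ρ,
        ((M k - 1) * A - B - 4 * Real.pi ^ 2 * A * ‖ξ‖ ^ 2) =
      w * ρ ^ d * ((M k - 1) * A - B) -
        4 * Real.pi ^ 2 * A * ((d : ℝ) / (d + 2) * ρ ^ 2 * (w * ρ ^ d)) := by
    rw [integral_sub, setIntegral_const, integral_const_mul, hnorm2, hvol, smul_eq_mul]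
    · exact integrableOn_const measure_closedBall_lt_top.ne
    · exact Continuous.continuousOn (by fun_prop) |>.integrableOn_compact hcomp
  have hright : ∫ ξ in Metric.closedBall (0 : E d) ρ,
        ∑ i ∈ Finset.range (k + 1), (M k - M i) * fourierSq hc hs (embedding Ω (q i)) ξ ≤
      ∑ i ∈ Finset.range (k + 1), (M k - M i) := by
    rw [integral_finsetSum _ fun i _ => hintF i]
    refine Finset.sum_le_sum fun i hi => ?_
    have hi' := Finset.mem_range.1 hi
    rw [integral_const_mul]
    -- Bessel's inequality bounds the integral by 1, and the weight `M k - M i` is nonnegative.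
    have b1 := integral_fourierSq_le hc hs h.smooth hφ1 k1 k2 ρ (q i)
    rw [h1 i hi', one_pow] at b1
    exact mul_le_of_le_one_right (by linarith [h2 i hi']) b1
  have hsum : ∑ j ∈ Finset.Icc 1 (k + 1), dirichletEigenvalue Ω j ≤
      ∑ i ∈ Finset.range (k + 1), (M i - 1) := by
    have e : ∑ j ∈ Finset.Icc 1 (k + 1), dirichletEigenvalue Ω j =
        ∑ i ∈ Finset.range (k + 1), dirichletEigenvalue Ω (i + 1) := by
      rw [Finset.range_eq_Ico, Finset.sum_Ico_add' _ 0 (k + 1) 1]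
      rfl
    rw [e]
    exact Finset.sum_le_sum fun i hi => h3 i (Finset.mem_range.1 hi)
  have hM : ∑ i ∈ Finset.range (k + 1), (M k - M i) =
      N * (M k - 1) - ∑ i ∈ Finset.range (k + 1), (M i - 1) := by
    simp only [Finset.sum_sub_distrib, Finset.sum_const, Finset.card_range, nsmul_eq_mul]
    rw [hN]; ring
  have hv : w * ρ ^ d = N / A := by rw [← hρd]; field_simp
  have hfin := hmono.trans hright
  rw [hleft, hM, hv] at hfin
  refine hsum.trans ?_
  have e1 : N / A * ((M k - 1) * A - B) = N * (M k - 1) - N * (B / A) := by field_simp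
  have e2 : 4 * Real.pi ^ 2 * A * ((d : ℝ) / (d + 2) * ρ ^ 2 * (N / A)) =
      N * ((d : ℝ) / (d + 2) * (classicalConst d * (N / A) ^ (2 / (d : ℝ)))) := by
    rw [← hρ2]; field_simp
  rw [e1, e2] at hfin
  linarith

/-! ### Smooth cutoffs -/

open scoped Convolution

/-- A segment from x to a point outside Ω crosses the boundary. Cutoffs are built from the distance
to `Ωᶜ`, since it vanishes outside Ω, unlike the distance to the boundary. -/
theorem bdryDist_le_infDist_compl (hopen : IsOpen Ω) (hne : Ωᶜ.Nonempty) {x : E d} (hx : x ∈ Ω) :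
    bdryDist Ω x ≤ Metric.infDist x Ωᶜ := by
  rw [Metric.le_infDist hne]
  intro y hy
  have hmeet : ∃ z ∈ segment ℝ x y, z ∈ frontier Ω := by
    by_contra hcon
    push Not at hcon
    have hpre : IsPreconnected (segment ℝ x y) := (convex_segment x y).isPreconnected
    have hcl : ∀ z ∈ segment ℝ x y, z ∈ closure Ω → z ∈ Ω := fun z hz hzc => by
      by_contra hzΩ
      exact hcon z hz ⟨hzc, by rwa [hopen.interior_eq]⟩
    obtain ⟨z, -, hz1, hz2⟩ := hpre Ω (closure Ω)ᶜ hopen isClosed_closure.isOpen_compl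
      (fun z hz => (em (z ∈ closure Ω)).imp (hcl z hz) id)
      ⟨x, left_mem_segment ℝ x y, hx⟩
      ⟨y, right_mem_segment ℝ x y, fun hyc => hy (hcl y (right_mem_segment ℝ x y) hyc)⟩
    exact hz2 (subset_closure hz1)
  obtain ⟨z, hz, hzf⟩ := hmeet
  refine (Metric.infDist_le_dist_of_mem hzf).trans ?_
  obtain ⟨a, b, ha, hb, hab, rfl⟩ := hz
  have e : x - (a • x + b • y) = b • (x - y) := by
    have : a = 1 - b := by linarith
    rw [this]; module
  rw [dist_eq_norm, dist_eq_norm, e, norm_smul, Real.norm_of_nonneg hb]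
  exact mul_le_of_le_one_left (norm_nonneg _) (by linarith)

/-- Mollification of a bounded Lipschitz function. -/
theorem exists_mollification {g : E d → ℝ} {K : NNReal} (hg : LipschitzWith K g)
    (h0 : ∀ x, 0 ≤ g x) (h1 : ∀ x, g x ≤ 1) {ε : ℝ} (hε : 0 < ε) :
    ∃ φ : E d → ℝ, ContDiff ℝ ∞ φ ∧ LipschitzWith K φ ∧ (∀ x, 0 ≤ φ x ∧ φ x ≤ 1) ∧
      ∀ x, (∀ y ∈ Metric.ball x ε, g y = g x) → φ x = g x := by
  let b : ContDiffBump (0 : E d) := ⟨ε / 2, ε, by positivity, by linarith⟩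
  let φ : E d → ℝ := b.normed volume ⋆[ContinuousLinearMap.lsmul ℝ ℝ, volume] g
  have hφ : ∀ x, φ x = ∫ t, b.normed volume t * g (x - t) := fun x => rfl
  have hint : ∀ x, Integrable fun t => b.normed volume t * g (x - t) := fun x => by
    have hc : Continuous fun t => b.normed volume t * g (x - t) := by
      have := hg.continuous
      have : Continuous (b.normed volume) := b.continuous_normed
      fun_prop
    exact hc.integrable_of_hasCompactSupport b.hasCompactSupport_normed.mul_right
  refine ⟨φ, ?_, ?_, fun x => ⟨?_, ?_⟩, ?_⟩
  · exact b.hasCompactSupport_normed.contDiff_convolution_left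
      (ContinuousLinearMap.lsmul ℝ ℝ) b.contDiff_normed
      hg.continuous.locallyIntegrable
  · refine LipschitzWith.of_dist_le_mul fun x y => ?_
    rw [Real.dist_eq, hφ, hφ, ← integral_sub (hint x) (hint y), ← Real.norm_eq_abs]
    refine le_trans (norm_integral_le_of_norm_le (μ := volume)
      (g := fun t : E d => b.normed volume t * (K * dist x y))
      (b.integrable_normed.mul_const _) (Eventually.of_forall fun t => ?_)) ?_
    · rw [← mul_sub, norm_mul, Real.norm_of_nonneg (b.nonneg_normed t), ← dist_eq_norm]
      refine mul_le_mul_of_nonneg_left ?_ (b.nonneg_normed t)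
      have := hg.dist_le_mul (x - t) (y - t)
      rwa [dist_sub_right] at this
    · rw [integral_mul_const, b.integral_normed, one_mul]
  · rw [hφ]
    exact integral_nonneg fun t => mul_nonneg (b.nonneg_normed t) (h0 _)
  · rw [hφ, ← b.integral_normed (μ := volume)]
    exact integral_mono (hint x) b.integrable_normed fun t =>
      mul_le_of_le_one_right (b.nonneg_normed t) (h1 _)
  · intro x hx
    exact b.normed_convolution_eq_right hx

/-- Smooth cutoffs of a bounded open set. -/
theorem exists_cutoff (hopen : IsOpen Ω) (hb : Bornology.IsBounded Ω)
    (hne : Ωᶜ.Nonempty) {η h : ℝ} (hη : 0 < η) (hηh : η < h) :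
    ∃ φ : E d → ℝ, IsTest Ω φ ∧ (∀ x, 0 ≤ φ x ∧ φ x ≤ 1) ∧
      (∀ x ∈ Ω \ tube Ω h, φ x = 1) ∧ (∀ x, ‖∇ φ x‖ ≤ η⁻¹) := by
  set D : E d → ℝ := fun x => Metric.infDist x Ωᶜ with hD
  have hDlip : LipschitzWith 1 D := Metric.lipschitz_infDist_pt _
  -- The ramp of width η runs from `D = 2ε` to `D = 2ε + η = h - 2ε`. The margin on either side lets
  -- mollification at scale ε keep the value 0 where `D < ε` and 1 where `D > h`.
  set ε : ℝ := (h - η) / 4 with hε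
  have hε0 : 0 < ε := by rw [hε]; linarith
  set g : E d → ℝ := fun x => max 0 (min 1 (η⁻¹ * (D x - 2 * ε))) with hg
  have hlin : LipschitzWith ⟨η⁻¹, by positivity⟩ fun x => η⁻¹ * (D x - 2 * ε) := by
    refine LipschitzWith.of_dist_le_mul fun x y => ?_
    change _ ≤ η⁻¹ * dist x y
    have h3 := hDlip.dist_le_mul x y
    rw [NNReal.coe_one, one_mul, Real.dist_eq] at h3
    rw [Real.dist_eq, ← mul_sub, abs_mul, abs_of_pos (by positivity : 0 < η⁻¹)]
    gcongr
    rwa [sub_sub_sub_cancel_right]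
  have hglip : LipschitzWith ⟨η⁻¹, by positivity⟩ g := (hlin.const_min 1).const_max 0
  obtain ⟨φ, k1, k2, k3, k4⟩ := exists_mollification hglip (fun x => le_max_left _ _)
    (fun x => max_le zero_le_one (min_le_left _ _)) hε0
  have hg0 : ∀ y, D y ≤ 2 * ε → g y = 0 := fun y hy => by
    have : η⁻¹ * (D y - 2 * ε) ≤ 0 := mul_nonpos_of_nonneg_of_nonpos (by positivity) (by linarith)
    rw [hg]
    exact max_eq_left ((min_le_right _ _).trans this)
  have hg1 : ∀ y, h - 2 * ε ≤ D y → g y = 1 := fun y hy => by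
    have : 1 ≤ η⁻¹ * (D y - 2 * ε) := by
      rw [inv_mul_eq_div, one_le_div hη]
      linarith
    simp only [hg]
    rw [min_eq_left this]
    exact max_eq_right zero_le_one
  have hDball : ∀ x y, y ∈ Metric.ball x ε → |D y - D x| < ε := fun x y hy => by
    have h3 := hDlip.dist_le_mul y x
    rw [NNReal.coe_one, one_mul, Real.dist_eq] at h3
    exact h3.trans_lt hy
  have hsupp : tsupport φ ⊆ {x | ε ≤ D x} := by
    refine closure_minimal (fun x hx => ?_) (isClosed_le continuous_const hDlip.continuous)
    by_contra hlt
    simp only [Set.mem_ofPred_eq, not_le] at hlt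
    apply hx
    rw [k4 x fun y hy => ?_, hg0 x (by linarith)]
    rw [hg0 x (by linarith), hg0 y (by linarith [(abs_lt.1 (hDball x y hy)).2])]
  have hsub : {x | ε ≤ D x} ⊆ Ω := fun x hx => by
    by_contra hxΩ
    have : D x = 0 := Metric.infDist_zero_of_mem hxΩ
    simp only [Set.mem_ofPred_eq] at hx
    linarith
  refine ⟨φ, ⟨k1, ?_, hsupp.trans hsub⟩, k3, ?_, fun x => ?_⟩
  · exact Metric.isCompact_of_isClosed_isBounded (isClosed_tsupport _)
      (hb.subset (hsupp.trans hsub))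
  · rintro x ⟨hx, hxt⟩
    have hxh : h < D x := by
      by_contra hle
      exact hxt ⟨hx, (bdryDist_le_infDist_compl hopen hne hx).trans (not_lt.1 hle)⟩
    rw [k4 x fun y hy => ?_, hg1 x (by linarith)]
    rw [hg1 x (by linarith), hg1 y (by linarith [(abs_lt.1 (hDball x y hy)).1])]
  · have h3 : ‖fderiv ℝ φ x‖ ≤ η⁻¹ := norm_fderiv_le_of_lipschitz ℝ k2
    rwa [gradient, LinearIsometryEquiv.norm_map]

/-! ### Tubular neighbourhoods and the bound on the mean -/

theorem isClosed_bdryDist_le (Ω : Set (E d)) (h : ℝ) : IsClosed {x | bdryDist Ω x ≤ h} :=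
  isClosed_le (Metric.continuous_infDist_pt _) continuous_const

theorem measurableSet_tube (hopen : IsOpen Ω) (h : ℝ) : MeasurableSet (tube Ω h) :=
  hopen.measurableSet.inter (isClosed_bdryDist_le Ω h).measurableSet

theorem tube_subset (Ω : Set (E d)) (h : ℝ) : tube Ω h ⊆ Ω := fun _ hx => hx.1

theorem volume_real_diff_tube (hopen : IsOpen Ω) (hb : Bornology.IsBounded Ω) (h : ℝ) :
    volume.real (Ω \ tube Ω h) = volume.real Ω - volume.real (tube Ω h) :=
  measureReal_sdiff (tube_subset Ω h) (measurableSet_tube hopen h) hb.measure_lt_top.ne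

/-- The `L²` norms of a smooth cutoff and of its gradient. -/
theorem exists_cutoff_integral (hopen : IsOpen Ω) (hb : Bornology.IsBounded Ω)
    (hne : Ωᶜ.Nonempty) {η h : ℝ} (hη : 0 < η) (hηh : η < h) :
    ∃ φ : E d → ℝ, IsTest Ω φ ∧ (∀ x, |φ x| ≤ 1) ∧
      volume.real Ω - volume.real (tube Ω h) ≤ ∫ x, φ x ^ 2 ∧
      ∫ x, ‖∇ φ x‖ ^ 2 ≤ volume.real (tube Ω h) / η ^ 2 := by
  obtain ⟨φ, k1, k2, k3, k4⟩ := exists_cutoff hopen hb hne hη hηh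
  have hm := measurableSet_tube hopen h
  have hfin : ∀ s ⊆ Ω, volume s ≠ ⊤ := fun s hs => ((measure_mono hs).trans_lt hb.measure_lt_top).ne
  refine ⟨φ, k1, fun x => abs_le.2 ⟨by linarith [(k2 x).1], (k2 x).2⟩, ?_, ?_⟩
  · rw [← volume_real_diff_tube hopen hb]
    calc volume.real (Ω \ tube Ω h) = ∫ x in Ω \ tube Ω h, (1 : ℝ) := by
          rw [setIntegral_const, smul_eq_mul, mul_one]
      _ = ∫ x in Ω \ tube Ω h, φ x ^ 2 :=
          setIntegral_congr_fun (hopen.measurableSet.diff hm) fun x hx => by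
            simp only [k3 x hx, one_pow]
      _ ≤ ∫ x, φ x ^ 2 := setIntegral_le_integral (integrable_sq_of_test k1)
          (Eventually.of_forall fun x => sq_nonneg _)
  · have hzero : ∀ x ∉ tube Ω h, ‖∇ φ x‖ ^ 2 = 0 := fun x hx => by
      by_cases hxΩ : x ∈ Ω
      · have hnhds : Ω ∩ {x | bdryDist Ω x ≤ h}ᶜ ∈ 𝓝 x :=
          (hopen.inter (isClosed_bdryDist_le Ω h).isOpen_compl).mem_nhds
            ⟨hxΩ, fun hx' => hx ⟨hxΩ, hx'⟩⟩
        have hev : φ =ᶠ[𝓝 x] fun _ => (1 : ℝ) := by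
          filter_upwards [hnhds] with y hy
          exact k3 y ⟨hy.1, fun hy' => hy.2 hy'.2⟩
        have : fderiv ℝ φ x = 0 := by rw [hev.fderiv_eq]; simp
        simp [gradient, this]
      · rw [k1.gradient_eq_zero_of_notMem hxΩ]; simp
    rw [← setIntegral_eq_integral_of_forall_compl_eq_zero hzero]
    calc ∫ x in tube Ω h, ‖∇ φ x‖ ^ 2 ≤ ∫ x in tube Ω h, (η ^ 2)⁻¹ := by
          refine setIntegral_mono_on (integrable_norm_sq_gradient_of_test k1).integrableOn
            (integrableOn_const (hfin _ (tube_subset Ω h))) hm fun x _ => ?_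
          rw [← inv_pow]
          gcongr
          exact k4 x
      _ = volume.real (tube Ω h) / η ^ 2 := by
          rw [setIntegral_const, smul_eq_mul, div_eq_mul_inv]

theorem classicalConst_pos (d : ℕ) : 0 < classicalConst d :=
  mul_pos (by have := Real.pi_pos; positivity) (Real.rpow_pos_of_pos (ballVolume_pos d) _)

theorem volume_real_pos (hopen : IsOpen Ω) (hne : Ω.Nonempty) (hb : Bornology.IsBounded Ω) :
    0 < volume.real Ω :=
  ENNReal.toReal_pos (hopen.measure_pos volume hne).ne' hb.measure_lt_top.ne

theorem compl_nonempty (hd : 0 < d) (hb : Bornology.IsBounded Ω) : Ωᶜ.Nonempty := by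
  have : Nonempty (Fin d) := ⟨⟨0, hd⟩⟩
  have : Nontrivial (E d) := inferInstance
  rw [Set.nonempty_compl]
  rintro rfl
  exact NormedSpace.unbounded_univ ℝ (E d) hb

theorem inradius_pos (hd : 0 < d) (hopen : IsOpen Ω) (hne : Ω.Nonempty)
    (hb : Bornology.IsBounded Ω) : 0 < inradius Ω := by
  obtain ⟨x, hx⟩ := hne
  have hfr : (frontier Ω).Nonempty :=
    nonempty_frontier_iff.2 ⟨⟨x, hx⟩, Set.nonempty_compl.1 (compl_nonempty hd hb)⟩
  have hpos : 0 < bdryDist Ω x := by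
    refine (isClosed_frontier.notMem_iff_infDist_pos hfr).1 fun hxf => ?_
    exact hxf.2 (by rwa [hopen.interior_eq])
  obtain ⟨z, hz⟩ := hfr
  obtain ⟨D, hD⟩ := hb.subset_closedBall z
  refine hpos.trans_le (le_csSup ⟨D, ?_⟩ ⟨x, hx, rfl⟩)
  rintro _ ⟨y, hy, rfl⟩
  exact (Metric.infDist_le_dist_of_mem hz).trans (hD hy)

/-- Some point of Ω is farther than h from the boundary, so the complement of the tube in Ω is open,
nonempty and of positive measure. -/
theorem volume_real_tube_lt (hopen : IsOpen Ω) (hne : Ω.Nonempty) (hb : Bornology.IsBounded Ω)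
    {h : ℝ} (hh : h < inradius Ω) : volume.real (tube Ω h) < volume.real Ω := by
  obtain ⟨_, ⟨x, hx, rfl⟩, hlt⟩ := exists_lt_of_lt_csSup (hne.image _) hh
  have hop : IsOpen (Ω ∩ {x | bdryDist Ω x ≤ h}ᶜ) :=
    hopen.inter (isClosed_bdryDist_le Ω h).isOpen_compl
  have heq : Ω \ tube Ω h = Ω ∩ {x | bdryDist Ω x ≤ h}ᶜ := by
    ext y
    constructor
    · rintro ⟨h1, h2⟩; exact ⟨h1, fun h3 => h2 ⟨h1, h3⟩⟩
    · rintro ⟨h1, h2⟩; exact ⟨h1, fun h3 => h2 h3.2⟩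
  have hpos := volume_real_pos hop ⟨x, hx, not_le.2 hlt⟩ (hb.subset Set.inter_subset_left)
  rw [← heq, volume_real_diff_tube hopen hb] at hpos
  linarith

/-- Smooth cutoffs attain the gradient bound `1/η` for every `η < h`; the slope `1/h` is reached in
the limit `η ↑ h`. -/
theorem mean_dirichletEigenvalue_le (hd : 0 < d) (hopen : IsOpen Ω) (hne : Ω.Nonempty)
    (hb : Bornology.IsBounded Ω) {h : ℝ} (hh : 0 < h)
    (hw : volume.real (tube Ω h) < volume.real Ω) {n : ℕ} (hn : 1 ≤ n) :
    1 / (n : ℝ) * ∑ j ∈ Finset.Icc 1 n, dirichletEigenvalue Ω j ≤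
      (d : ℝ) / (d + 2) * classicalConst d *
          (n / (volume.real Ω - volume.real (tube Ω h))) ^ (2 / (d : ℝ)) +
        volume.real (tube Ω h) / h ^ 2 / (volume.real Ω - volume.real (tube Ω h)) := by
  set V := volume.real Ω
  set w := volume.real (tube Ω h)
  have hVw : 0 < V - w := by linarith
  have hn0 : (0 : ℝ) < n := by exact_mod_cast hn
  have hC := classicalConst_pos d
  have key : ∀ η ∈ Set.Ioo 0 h, 1 / (n : ℝ) * ∑ j ∈ Finset.Icc 1 n, dirichletEigenvalue Ω j ≤
      (d : ℝ) / (d + 2) * classicalConst d * (n / (V - w)) ^ (2 / (d : ℝ)) +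
        w / η ^ 2 / (V - w) := by
    rintro η ⟨hη, hηh⟩
    obtain ⟨φ, h1, h2, h3, h4⟩ := exists_cutoff_integral hopen hb (compl_nonempty hd hb) hη hηh
    have hA : 0 < ∫ x, φ x ^ 2 := hVw.trans_le h3
    have h5 := sum_dirichletEigenvalue_le hd hopen hne hb h1 h2 hA hn
    rw [one_div, inv_mul_le_iff₀ hn0]
    refine h5.trans ?_
    have h6 : 0 ≤ w / η ^ 2 := div_nonneg measureReal_nonneg (sq_nonneg _)
    gcongr
  have hlim : Tendsto (fun η : ℝ => (d : ℝ) / (d + 2) * classicalConst d *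
      (n / (V - w)) ^ (2 / (d : ℝ)) + w / η ^ 2 / (V - w)) (𝓝[<] h)
      (𝓝 ((d : ℝ) / (d + 2) * classicalConst d * (n / (V - w)) ^ (2 / (d : ℝ)) +
        w / h ^ 2 / (V - w))) := by
    have hc : ContinuousAt (fun η : ℝ => (d : ℝ) / (d + 2) * classicalConst d *
      (n / (V - w)) ^ (2 / (d : ℝ)) + w / η ^ 2 / (V - w)) h := by
      have : h ^ 2 ≠ 0 := by positivity
      fun_prop (disch := assumption)
    exact hc.tendsto.mono_left nhdsWithin_le_nhds
  exact ge_of_tendsto hlim (by filter_upwards [Ioo_mem_nhdsLT hh] with η hη using key η hη)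

/-! ### The choice of tube width and the remainder -/

theorem tubeWidth_eq (hd : 0 < d) {V : ℝ} (hV : 0 < V) {n : ℕ} (hn : 1 ≤ n) :
    tubeWidth d V n = ((2 * classicalConst d / (d + 2)) ^ (1 / 2 : ℝ) *
      ((n : ℝ) / V) ^ (1 / (d : ℝ)))⁻¹ := by
  have hC := classicalConst_pos d
  have hn0 : (0 : ℝ) < n := by exact_mod_cast hn
  rw [tubeWidth, Real.rpow_neg (by positivity), Real.rpow_neg hn0.le,
    Real.div_rpow (by positivity) (by positivity), Real.div_rpow hn0.le hV.le]
  have := Real.rpow_pos_of_pos hV (1 / (d : ℝ))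
  field_simp

theorem tubeWidth_pos (hd : 0 < d) {V : ℝ} (hV : 0 < V) {n : ℕ} (hn : 1 ≤ n) :
    0 < tubeWidth d V n := by
  have hC := classicalConst_pos d
  have hn0 : (0 : ℝ) < n := by exact_mod_cast hn
  rw [tubeWidth_eq hd hV hn]
  positivity

/-- This is the equation `1/h² = a` for the minimizer of `a h + 1/h`: the gradient cost balances the
volume lost in the Weyl term. -/
theorem one_div_tubeWidth_sq (hd : 0 < d) {V : ℝ} (hV : 0 < V) {n : ℕ} (hn : 1 ≤ n) :
    1 / tubeWidth d V n ^ 2 =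
      2 / ((d : ℝ) + 2) * classicalConst d * ((n : ℝ) / V) ^ (2 / (d : ℝ)) := by
  have hC := classicalConst_pos d
  have hn0 : (0 : ℝ) < n := by exact_mod_cast hn
  rw [tubeWidth_eq hd hV hn, inv_pow, one_div, inv_inv, mul_pow,
    ← Real.rpow_mul_natCast (by positivity), ← Real.rpow_mul_natCast (by positivity)]
  have e : 1 / (d : ℝ) * (2 : ℕ) = 2 / d := by push_cast; ring
  rw [e, show (1 / 2 : ℝ) * (2 : ℕ) = 1 by norm_num, Real.rpow_one]
  ring

/-- The threshold is the value of k at which the tube width equals r; compare d-th powers. -/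
theorem tubeWidth_lt (hd : 0 < d) {V r : ℝ} (hV : 0 < V) (hr : 0 < r) {n : ℕ} (hn : 1 ≤ n)
    (h : V * r ^ (-(d : ℝ)) * (((d : ℝ) + 2) / (2 * classicalConst d)) ^ ((d : ℝ) / 2) < n) :
    tubeWidth d V n < r := by
  have hC := classicalConst_pos d
  have hn0 : (0 : ℝ) < n := by exact_mod_cast hn
  have hdR : (0 : ℝ) < d := by exact_mod_cast hd
  have hpow : tubeWidth d V n ^ d =
      (((d : ℝ) + 2) / (2 * classicalConst d)) ^ ((d : ℝ) / 2) * V / n := by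
    rw [tubeWidth_eq hd hV hn, inv_pow, mul_pow, ← Real.rpow_mul_natCast (by positivity),
      ← Real.rpow_mul_natCast (by positivity), one_div_mul_cancel hdR.ne', Real.rpow_one,
      one_div_mul_eq_div, mul_inv, ← Real.inv_rpow (by positivity), inv_div, inv_div, mul_div_assoc]
  refine lt_of_pow_lt_pow_left₀ d hr.le ?_
  rw [hpow, div_lt_iff₀ hn0]
  rw [Real.rpow_neg hr.le, Real.rpow_natCast] at h
  have hrd : 0 < r ^ d := by positivity
  calc _ = r ^ d * (V * (r ^ d)⁻¹ *
        (((d : ℝ) + 2) / (2 * classicalConst d)) ^ ((d : ℝ) / 2)) := by field_simp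
    _ < r ^ d * n := by gcongr

/-- Bernoulli's inequality turns the trial bound into the bound with the explicit remainder. -/
theorem trial_bound_le_remainder_bound (hd : 2 ≤ d) {V S w : ℝ} (hV : 0 < V) (hw0 : 0 ≤ w)
    (hw : w < V) {n : ℕ} (hn : 1 ≤ n) :
    (d : ℝ) / (d + 2) * classicalConst d * (n / (V - w)) ^ (2 / (d : ℝ)) +
        w / tubeWidth d V n ^ 2 / (V - w) ≤
      (d : ℝ) / ((d : ℝ) + 2) * classicalConst d * ((n : ℝ) / V) ^ (2 / (d : ℝ)) +
        2 * (2 * classicalConst d / ((d : ℝ) + 2)) ^ (1 / 2 : ℝ) * (S / V) *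
          ((n : ℝ) / V) ^ (1 / (d : ℝ)) + remainder d V S w n := by
  have hC := classicalConst_pos d
  have hd0 : 0 < d := by omega
  have hn0 : (0 : ℝ) < n := by exact_mod_cast hn
  have hdR : (2 : ℝ) ≤ d := by exact_mod_cast hd
  have hVw : 0 < V - w := by linarith
  have h1 := one_div_tubeWidth_sq hd0 hV hn
  have h2 := tubeWidth_eq hd0 hV hn
  have h3 := tubeWidth_pos hd0 hV hn
  set t := tubeWidth d V n with ht
  have h4 : (2 * classicalConst d / ((d : ℝ) + 2)) ^ (1 / 2 : ℝ) * ((n : ℝ) / V) ^ (1 / (d : ℝ)) =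
      t⁻¹ := by rw [h2, inv_inv]
  -- Bernoulli's inequality for the exponent `2/d ≤ 1`; this is where `d ≥ 2` enters.
  have h5 : (n / (V - w)) ^ (2 / (d : ℝ)) ≤
      (n / V) ^ (2 / (d : ℝ)) * (1 + 2 / (d : ℝ) * (w / (V - w))) := by
    have e : (n : ℝ) / (V - w) = n / V * (1 + w / (V - w)) := by field_simp; ring
    rw [e, Real.mul_rpow (by positivity) (by positivity)]
    gcongr
    refine rpow_one_add_le_one_add_mul_self ?_ (by positivity) ?_
    · have : 0 ≤ w / (V - w) := by positivity
      linarith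
    · rw [div_le_one (by linarith)]; exact hdR
  set P := (n / V : ℝ) ^ (2 / (d : ℝ)) with hP
  have h6 : (d : ℝ) / (d + 2) * classicalConst d * (n / (V - w)) ^ (2 / (d : ℝ)) ≤
      (d : ℝ) / (d + 2) * classicalConst d * P + 1 / t ^ 2 * (w / (V - w)) := by
    rw [h1]
    calc _ ≤ (d : ℝ) / (d + 2) * classicalConst d * (P * (1 + 2 / (d : ℝ) * (w / (V - w)))) := by
          gcongr
      _ = _ := by field_simp
  have h7 : remainder d V S w n =
      (1 / t ^ 2 + 1 / t ^ 2) * ((t * S * w + V * (w - t * S)) / (V * (V - w))) := by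
    rw [remainder, ← ht, h1]
  have h8 : 2 * (2 * classicalConst d / ((d : ℝ) + 2)) ^ (1 / 2 : ℝ) * (S / V) *
      ((n : ℝ) / V) ^ (1 / (d : ℝ)) = 2 * t⁻¹ * (S / V) := by rw [← h4]; ring
  -- S cancels: boundary term plus remainder equals `2 w / (t² (V - w))` exactly, so Bernoulli is
  -- the only loss here.
  have h9 : 2 * t⁻¹ * (S / V) +
      (1 / t ^ 2 + 1 / t ^ 2) * ((t * S * w + V * (w - t * S)) / (V * (V - w))) =
      1 / t ^ 2 * (w / (V - w)) + w / t ^ 2 / (V - w) := by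
    field_simp
    ring
  rw [h7, h8]
  linarith

theorem tendsto_volume_real_tube_div (hS : ClassS Ω) :
    Tendsto (fun h : ℝ => volume.real (tube Ω h) / h) (𝓝[>] 0)
      (𝓝 (surfaceMeasure Ω).toReal) := by
  refine ((ENNReal.tendsto_toReal hS.finite).comp hS.tendsto).congr' ?_
  filter_upwards [self_mem_nhdsWithin] with h hh
  rw [Function.comp_apply, ENNReal.toReal_div, ENNReal.toReal_ofReal (le_of_lt hh), measureReal_def]

theorem tendsto_tubeWidth (hd : 0 < d) {V : ℝ} (hV : 0 < V) :
    Tendsto (tubeWidth d V) atTop (𝓝[>] 0) := by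
  have hdR : (0 : ℝ) < d := by exact_mod_cast hd
  refine tendsto_nhdsWithin_iff.2 ⟨?_, ?_⟩
  · have h1 : Tendsto (fun k : ℕ => (k : ℝ) ^ (-(1 / (d : ℝ)))) atTop (𝓝 0) :=
      (tendsto_rpow_neg_atTop (by positivity)).comp tendsto_natCast_atTop_atTop
    have h2 := h1.const_mul
      (((d : ℝ) + 2) ^ (1 / 2 : ℝ) * (2 * classicalConst d) ^ (-(1 / 2) : ℝ) * V ^ (1 / (d : ℝ)))
    rwa [mul_zero] at h2
  · filter_upwards [eventually_ge_atTop 1] with n hn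
    exact tubeWidth_pos hd hV hn

theorem remainder_isLittleO (hd : 0 < d) (hopen : IsOpen Ω) (hne : Ω.Nonempty) (hS : ClassS Ω) :
    (fun k : ℕ => remainder d (volume.real Ω) (surfaceMeasure Ω).toReal
      (volume.real (tube Ω (tubeWidth d (volume.real Ω) k))) k) =o[atTop]
      (fun k : ℕ => (k : ℝ) ^ (1 / (d : ℝ))) := by
  have hV := volume_real_pos hopen hne hS.bounded
  have hC := classicalConst_pos d
  set V := volume.real Ω
  set S := (surfaceMeasure Ω).toReal
  set c : ℝ := V ^ (1 / (d : ℝ)) / (2 * classicalConst d / ((d : ℝ) + 2)) ^ (1 / 2 : ℝ) with hc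
  have hc0 : 0 < c := by positivity
  have ht := tendsto_tubeWidth hd hV
  have hq : Tendsto (fun k => volume.real (tube Ω (tubeWidth d V k)) / tubeWidth d V k) atTop
      (𝓝 S) := (tendsto_volume_real_tube_div hS).comp ht
  have ht0 : Tendsto (tubeWidth d V) atTop (𝓝 0) := tendsto_nhds_of_tendsto_nhdsWithin ht
  have hw : Tendsto (fun k => volume.real (tube Ω (tubeWidth d V k))) atTop (𝓝 0) := by
    have h1 := hq.mul ht0
    rw [mul_zero] at h1
    refine h1.congr' ?_
    filter_upwards [eventually_ge_atTop 1] with k hk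
    exact div_mul_cancel₀ _ (tubeWidth_pos hd hV hk).ne'
  rw [isLittleO_iff_tendsto']
  -- With `k^(1/d) = c / t`, the quotient becomes this expression in `w` and `w / t`, and it tends
  -- to 0 as `w → 0` and `w / t → S`.
  · have hlim : Tendsto (fun k => 2 * c⁻¹ * ((S * volume.real (tube Ω (tubeWidth d V k)) +
        V * (volume.real (tube Ω (tubeWidth d V k)) / tubeWidth d V k - S)) /
        (V * (V - volume.real (tube Ω (tubeWidth d V k)))))) atTop
        (𝓝 (2 * c⁻¹ * ((S * 0 + V * (S - S)) / (V * (V - 0))))) := by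
      refine Tendsto.const_mul _ (Tendsto.div ?_ ?_ ?_)
      · exact (hw.const_mul S).add ((hq.sub_const S).const_mul V)
      · exact (hw.const_sub V).const_mul V
      · rw [sub_zero]; positivity
    simp only [mul_zero, sub_self, add_zero, zero_div] at hlim
    refine hlim.congr' ?_
    filter_upwards [eventually_ge_atTop 1] with k hk
    have hk0 : (0 : ℝ) < k := by exact_mod_cast hk
    have h1 := one_div_tubeWidth_sq hd hV hk
    have h2 := tubeWidth_eq hd hV hk
    have h3 := tubeWidth_pos hd hV hk
    rw [remainder, ← h1]
    have h4 : (k : ℝ) ^ (1 / (d : ℝ)) = c * (tubeWidth d V k)⁻¹ := by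
      rw [h2, inv_inv, hc, Real.div_rpow hk0.le hV.le]
      field_simp
    rw [h4]
    generalize volume.real (tube Ω (tubeWidth d V k)) = w
    generalize tubeWidth d V k = t at h3
    -- If the tube fills Ω up to a null set, both sides are 0 by the convention `x / 0 = 0`.
    by_cases hVw : V - w = 0
    · simp [hVw]
    · field_simp
      ring
  · filter_upwards [eventually_ge_atTop 1] with k hk h0
    have hk0 : (0 : ℝ) < k := by exact_mod_cast hk
    exact absurd h0 (by positivity)

end DirichletMeans

/-! ### Conclusion -/

theorem mainTheorem3 (d : ℕ) (hd : 2 ≤ d) (Ω : Set (DirichletMeans.E d))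
    (hopen : IsOpen Ω) (hne : Ω.Nonempty) (hS : DirichletMeans.ClassS Ω) :
    ∃ R : ℕ → ℝ,
      (∀ k : ℕ,
        volume.real Ω * DirichletMeans.inradius Ω ^ (-(d : ℝ)) *
            (((d : ℝ) + 2) / (2 * DirichletMeans.classicalConst d)) ^ ((d : ℝ) / 2) ≤ (k : ℝ) →
        1 / (k : ℝ) * ∑ j ∈ Finset.Icc 1 k, DirichletMeans.dirichletEigenvalue Ω j ≤
          (d : ℝ) / ((d : ℝ) + 2) * DirichletMeans.classicalConst d *
              ((k : ℝ) / volume.real Ω) ^ (2 / (d : ℝ)) +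
            2 * (2 * DirichletMeans.classicalConst d / ((d : ℝ) + 2)) ^ (1 / 2 : ℝ) *
              ((DirichletMeans.surfaceMeasure Ω).toReal / volume.real Ω) *
              ((k : ℝ) / volume.real Ω) ^ (1 / (d : ℝ)) +
            R k) ∧
      (∀ k : ℕ,
        volume.real Ω * DirichletMeans.inradius Ω ^ (-(d : ℝ)) *
            (((d : ℝ) + 2) / (2 * DirichletMeans.classicalConst d)) ^ ((d : ℝ) / 2) < (k : ℝ) →
        volume.real (DirichletMeans.tube Ω (DirichletMeans.tubeWidth d (volume.real Ω) k)) <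
            volume.real Ω ∧
          R k = DirichletMeans.remainder d (volume.real Ω)
            (DirichletMeans.surfaceMeasure Ω).toReal
            (volume.real (DirichletMeans.tube Ω
              (DirichletMeans.tubeWidth d (volume.real Ω) k))) k) ∧
      R =o[atTop] (fun k : ℕ => (k : ℝ) ^ (1 / (d : ℝ))) := by
  have hd0 : 0 < d := by omega
  have hV := DirichletMeans.volume_real_pos hopen hne hS.bounded
  have hr := DirichletMeans.inradius_pos hd0 hopen hne hS.bounded
  have hC := DirichletMeans.classicalConst_pos d
  set V := volume.real Ω with hVdef
  set S := (DirichletMeans.surfaceMeasure Ω).toReal with hSdef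
  set k₀ : ℝ := V * DirichletMeans.inradius Ω ^ (-(d : ℝ)) *
    (((d : ℝ) + 2) / (2 * DirichletMeans.classicalConst d)) ^ ((d : ℝ) / 2) with hk₀
  have hk₀0 : 0 < k₀ := by positivity
  set rem : ℕ → ℝ := fun k => DirichletMeans.remainder d V S
    (volume.real (DirichletMeans.tube Ω (DirichletMeans.tubeWidth d V k))) k with hrem
  set main : ℕ → ℝ := fun k => (d : ℝ) / ((d : ℝ) + 2) * DirichletMeans.classicalConst d *
      ((k : ℝ) / V) ^ (2 / (d : ℝ)) +
    2 * (2 * DirichletMeans.classicalConst d / ((d : ℝ) + 2)) ^ (1 / 2 : ℝ) * (S / V) *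
      ((k : ℝ) / V) ^ (1 / (d : ℝ)) with hmain
  have hlt : ∀ k : ℕ, k₀ < k → 1 ≤ k ∧
      volume.real (DirichletMeans.tube Ω (DirichletMeans.tubeWidth d V k)) < V := by
    intro k hk
    have hk1 : 1 ≤ k := by
      have : (0 : ℝ) < k := hk₀0.trans hk
      exact_mod_cast this
    exact ⟨hk1, DirichletMeans.volume_real_tube_lt hopen hne hS.bounded
      (DirichletMeans.tubeWidth_lt hd0 hV hr hk1 hk)⟩
  -- Up to and including `k₀`, R is defined as the actual excess, which makes the inequality an
  -- equality. At `k = k₀` the tube width is the inradius, the tube is all of Ω and the formula has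
  -- a vanishing denominator. Finitely many values do not affect the asymptotics.
  refine ⟨fun k => if k₀ < k then rem k else
    1 / (k : ℝ) * ∑ j ∈ Finset.Icc 1 k, DirichletMeans.dirichletEigenvalue Ω j - main k,
    fun k _ => ?_, fun k hk => ⟨(hlt k hk).2, if_pos hk⟩, ?_⟩
  · by_cases hk : k₀ < k
    · simp only [if_pos hk]
      obtain ⟨hk1, hw⟩ := hlt k hk
      exact (DirichletMeans.mean_dirichletEigenvalue_le hd0 hopen hne hS.bounded
        (DirichletMeans.tubeWidth_pos hd0 hV hk1) hw hk1).trans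
        (DirichletMeans.trial_bound_le_remainder_bound hd hV measureReal_nonneg hw hk1)
    · simp only [if_neg hk]
      rw [hmain]
      linarith
  · refine (DirichletMeans.remainder_isLittleO hd0 hopen hne hS).congr' ?_ EventuallyEq.rfl
    filter_upwards [tendsto_natCast_atTop_atTop.eventually_gt_atTop k₀] with k hk
    exact (if_pos hk).symm
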